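/- Let $d\ge 1$, $0<\alpha\le 2$, and let $\beta,\lambda,K,\mathrm{Lip}_\sigma>0$. Let $p(t,x)$ $(t>0,\ x\in\mathbf R^d)$ be the transition density of the symmetric $\alpha$-stable process on $\mathbf R^d$, i.e. the function with $\int_{\mathbf R^d}e^{i\langle x,\xi\rangle}p(t,x)\,dx=e^{-t|\xi|^\alpha}$, and let $C(d,\alpha)$ be the least constant $C$ with $p(t,x)\le C\big(t^{-d/\alpha}\wedge \frac{t}{|x|^{d+\alpha}}\big)$ for all $t>0$, $x\in\mathbf R^d$. Put $\gamma=(1-d)/\alpha$ and $$C_{d,\alpha,\beta}=2\,C(d,\alpha)\,\frac{d+\alpha}{d+\alpha-1}\,\frac{\Gamma(\gamma+1)}{\beta^{\gamma+1}},$$ where $C_{d,\alpha,\beta}$ is read as $0$ if $\Gamma(\gamma+1)$ is negative or undefined (possible only if $\gamma+1\le 0$). Let $\nu$ be a Borel measure on $\mathbf R^d$ with $\int (1\wedge|h|^2)\,\nu(dh)<\infty$, let $N$ be a Poisson random measure on $\mathbf R_+\times\mathbf R^d\times\mathbf R^d$ with intensity $dt\,dx\,\nu(dh)$ on a probability space $(\Omega,\mathcal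 F,\mathbf P)$, and let $(\mathcal F_t)$ be its natural filtration augmented by the null sets. Let $u_0:\mathbf R^d\to\mathbf R_+$ be bounded and measurable. Let $\sigma:\mathbf R\times\mathbf R^d\to\mathbf R$ be measurable, and suppose that there is a measurable $J:\mathbf R^d\to(0,\infty)$ with $\int J\,d\nu\le K$ such that, for all $x,y\in\mathbf R$ and $h\in\mathbf R^d$, $$|\sigma(0,h)|\le J(h),\qquad |\sigma(x,h)-\sigma(y,h)|\le J(h)\,\mathrm{Lip}_\sigma|x-y| .$$ A *random field solution* is a predictable random field $u=\{u(t,x)\}_{t\ge0,\,x\in\mathbf R^d}$ with $\sup_{0\le t\le T}\sup_{x}\mathbf E|u(t,x)|<\infty$ for all $T>0$, such that for every $x$ almost surely $u(0,x)=u_0(x)$, and for every $t>0$ and $x$ almost surely $$u(t,x)=\int_{\mathbf R^d}p(t,x-y)u_0(y)\,dy+\lambda\int_0^t\!\int_{\mathbf R^d}\!\int_{\mathbf R^d}p(t-s,x-y)\,\sigma(u(s,y),h)\,N(dh,dy,ds),$$ where the integrand is predictable with $\int_0^t\!\int\!\int\mathbf E|p(t-s,x-y)\,\sigma(u(s,y),h)|\,\nu(dh)\,dy\,ds<\infty$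 and the integral is the sum over the points of $N$ with time in $(0,t]$. Write $\|u\|_{1,\beta}=\sup_{t\ge0}\sup_{x}e^{-\beta t}\mathbf E|u(t,x)|$. **Theorem 4.4.** If $C_{d,\alpha,\beta}<\dfrac{1}{\lambda K\,\mathrm{Lip}_\sigma}$, then there exists a random field solution $u$, and it is unique up to modification: every random field solution $v$ satisfies $v(t,x)=u(t,x)$ almost surely, for each $t\ge 0$ and $x\in\mathbf R^d$. Moreover $\|u\|_{1,\beta'}<\infty$ for every $\beta'>\lambda K\,\mathrm{Lip}_\sigma$, and $\|u\|_{1,\beta}<\infty$ if $d=1$. -/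

import Mathlib

open MeasureTheory Set
open scoped NNReal ENNReal

noncomputable section

namespace StableSHE

/-- The space `ℝ^d` with its Euclidean norm; it carries both the positions and the jump sizes. -/
abbrev Space (d : ℕ) : Type := EuclideanSpace ℝ (Fin d)

variable {d : ℕ} {Ω : Type*} [MeasurableSpace Ω]

/-! ### The heat kernel of the symmetric stable process -/

/-- The transition density `p(t, x)` of the symmetric `α`-stable process on `ℝ^d`, i.e. the function
whose Fourier transform is `ξ ↦ exp (-t |ξ|^α)`, written out by Fourier inversion:
`p(t, x) = (2π)^{-d} ∫ e^{-i⟨x, ξ⟩} e^{-t |ξ|^α} dξ` (the imaginary part vanishes by symmetry).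
It is meaningful for `t > 0`. -/
def stableDensity (α t : ℝ) (x : Space d) : ℝ :=
  ((2 * Real.pi) ^ d)⁻¹ * ∫ ξ : Space d, Real.cos (inner ℝ x ξ) * Real.exp (-(t * ‖ξ‖ ^ α))

/-- The constant `C(d, α)` of the upper heat kernel estimate: the least `C` (possibly `∞`) with
`p(t, x) ≤ C (t^{-d/α} ∧ t / |x|^{d+α})` for all `t > 0` and all `x`. The two bounds are
multiplied out, so that at `x = 0` the second one is void. It is at most any other constant for
which the estimate holds. -/
def heatKernelConst (d : ℕ) (α : ℝ) : ℝ≥0∞ :=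
  ⨆ (t : ℝ) (_ : 0 < t) (x : Space d),
    ENNReal.ofReal (max (t ^ ((d : ℝ) / α) * stableDensity α t x)
      (‖x‖ ^ ((d : ℝ) + α) / t * stableDensity α t x))

/-- `C_{d,α,β} = 2 C(d,α) · (d+α)/(d+α-1) · Γ(γ+1)/β^{γ+1}` with `γ = (1-d)/α`, read as `0` where
the Gamma factor is negative or undefined (this can only happen for `γ + 1 ≤ 0`). -/
def solutionConst (d : ℕ) (α β : ℝ) : ℝ≥0∞ :=
  2 * heatKernelConst d α *
    ENNReal.ofReal (((d : ℝ) + α) / ((d : ℝ) + α - 1) *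
      (Real.Gamma ((1 - (d : ℝ)) / α + 1) / β ^ ((1 - (d : ℝ)) / α + 1)))

/-! ### The Poisson random measure -/

/-- The intensity `dt dx ν(dh)` on `ℝ_+ × ℝ^d × ℝ^d`. -/
def intensity (ν : Measure (Space d)) : Measure (ℝ≥0 × Space d × Space d) :=
  ((volume : Measure ℝ).comap ((↑) : ℝ≥0 → ℝ)).prod ((volume : Measure (Space d)).prod ν)

/-- `N` is a Poisson random measure with intensity `μ` on the probability space `(Ω, P)`. -/
structure IsPoissonRandomMeasure {X : Type*} [MeasurableSpace X] (N : Ω → Measure X)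
    (μ : Measure X) (P : Measure Ω) : Prop where
  measurable : Measurable N
  integer_valued : ∀ ω A, MeasurableSet A → ∃ n : ℕ∞, N ω A = (n : ℝ≥0∞)
  poisson : ∀ A, MeasurableSet A → μ A ≠ ∞ → ∀ n : ℕ,
    P {ω | N ω A = n} =
      ENNReal.ofReal ((μ A).toReal ^ n * Real.exp (-(μ A).toReal) / (n.factorial : ℝ))
  infinite : ∀ A, MeasurableSet A → μ A = ∞ → ∀ᵐ ω ∂P, N ω A = ∞
  indep : ∀ (k : ℕ) (A : Fin k → Set X), (∀ i, MeasurableSet (A i)) →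
    Pairwise (fun i j => Disjoint (A i) (A j)) →
    ProbabilityTheory.iIndepFun (fun i ω => N ω (A i)) P

/-- The filtration of `N`: `ℱ_t` is generated by the variables `N(C)`, `C` a measurable subset of
`[0, t] × ℝ^d × ℝ^d`, together with the null sets. -/
def noiseFiltration (N : Ω → Measure (ℝ≥0 × Space d × Space d)) (hN : Measurable N)
    (P : Measure Ω) : Filtration ℝ≥0 (inferInstance : MeasurableSpace Ω) where
  seq t :=
    (⨆ (C : Set (ℝ≥0 × Space d × Space d)) (_ : MeasurableSet C) (_ : C ⊆ Iic t ×ˢ univ),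
      MeasurableSpace.comap (fun ω => N ω C) inferInstance) ⊔
    MeasurableSpace.generateFrom {A : Set Ω | MeasurableSet A ∧ P A = 0}
  mono' := by
    intro s t hst
    refine sup_le_sup_right ?_ _
    exact iSup_mono fun C => iSup_mono fun _ =>
      iSup_mono' fun h => ⟨h.trans (prod_mono (Iic_subset_Iic.2 hst) subset_rfl), le_rfl⟩
  le' := by
    intro t
    refine sup_le (iSup_le fun C => iSup_le fun hC => iSup_le fun _ => ?_)
      (MeasurableSpace.generateFrom_le fun A hA => hA.1)
    exact ((Measure.measurable_coe hC).comp hN).comap_le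

/-- A random field `u(t, x, ω)` is predictable: jointly measurable for the product of the
predictable σ-algebra on `ℝ_+ × Ω` and the Borel σ-algebra of `ℝ^d`. -/
def IsPredictableField (ℱ : Filtration ℝ≥0 (inferInstance : MeasurableSpace Ω))
    (u : ℝ≥0 → Space d → Ω → ℝ) : Prop :=
  Measurable[ℱ.predictable.prod (inferInstance : MeasurableSpace (Space d))]
    (fun q : (ℝ≥0 × Ω) × Space d => u q.1.1 q.2 q.1.2)

/-- The class of integrands up to time `t` of the non-compensated Poisson integral: predictable
`f(s, y, h, ω)` with `∫_0^t ∫ ∫ E|f(s, y, h)| ν(dh) dy ds < ∞`. -/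
def IsPoissonIntegrand (ℱ : Filtration ℝ≥0 (inferInstance : MeasurableSpace Ω)) (P : Measure Ω)
    (ν : Measure (Space d)) (t : ℝ≥0) (f : ℝ≥0 → Space d → Space d → Ω → ℝ) : Prop :=
  Measurable[ℱ.predictable.prod (inferInstance : MeasurableSpace (Space d × Space d))]
      (fun q : (ℝ≥0 × Ω) × Space d × Space d => f q.1.1 q.2.1 q.2.2 q.1.2) ∧
    (∫⁻ z in Ioc 0 t ×ˢ univ, (∫⁻ ω, ‖f z.1 z.2.1 z.2.2 ω‖ₑ ∂P) ∂(intensity ν)) < ∞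

/-- The non-compensated integral `∫_0^t ∫ ∫ f(s, y, h) N(dh, dy, ds)`, taken path by path against
the measure `N ω`, i.e. the sum of `f` over the points of `N ω` with time in `(0, t]`. -/
def poissonIntegral (N : Ω → Measure (ℝ≥0 × Space d × Space d)) (t : ℝ≥0)
    (f : ℝ≥0 → Space d → Space d → Ω → ℝ) (ω : Ω) : ℝ :=
  ∫ z in Ioc 0 t ×ˢ univ, f z.1 z.2.1 z.2.2 ω ∂(N ω)

/-! ### Solutions -/

/-- The integrand `p(t-s, x-y) σ(u(s, y), h)` of the mild formulation at `(t, x)`. -/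
def mildIntegrand (α : ℝ) (σ : ℝ → Space d → ℝ) (u : ℝ≥0 → Space d → Ω → ℝ) (t : ℝ≥0)
    (x : Space d) : ℝ≥0 → Space d → Space d → Ω → ℝ :=
  fun s y h ω => stableDensity α ((t : ℝ) - (s : ℝ)) (x - y) * σ (u s y ω) h

/-- The weighted first moment norm `‖u‖_{1,β} = sup_{t ≥ 0} sup_x e^{-βt} E|u(t, x)|`,
with values in `[0, ∞]`. -/
def firstMomentNorm (P : Measure Ω) (β : ℝ) (u : ℝ≥0 → Space d → Ω → ℝ) : ℝ≥0∞ :=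
  ⨆ (t : ℝ≥0) (x : Space d), ENNReal.ofReal (Real.exp (-(β * t))) * ∫⁻ ω, ‖u t x ω‖ₑ ∂P

/-- `u` is a (predictable, mild) random field solution of the stochastic heat equation
`∂_t u = -(-Δ)^{α/2} u + λ ∫ σ(u, h) N(dh, dx, dt)`, `u(0, ·) = u₀`, whose first moment is bounded
uniformly in space and locally uniformly in time. -/
structure IsRandomFieldSolution (P : Measure Ω) (ν : Measure (Space d))
    (N : Ω → Measure (ℝ≥0 × Space d × Space d)) (hN : Measurable N) (α lam : ℝ)
    (σ : ℝ → Space d → ℝ) (u₀ : Space d → ℝ) (u : ℝ≥0 → Space d → Ω → ℝ) : Prop where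
  predictable : IsPredictableField (noiseFiltration N hN P) u
  initial : ∀ x, ∀ᵐ ω ∂P, u 0 x ω = u₀ x
  integrand : ∀ t, 0 < t → ∀ x,
    IsPoissonIntegrand (noiseFiltration N hN P) P ν t (mildIntegrand α σ u t x)
  mild : ∀ t, 0 < t → ∀ x, ∀ᵐ ω ∂P,
    u t x ω = (∫ y, stableDensity α t (x - y) * u₀ y) +
      lam * poissonIntegral N t (mildIntegrand α σ u t x) ω
  moment : ∀ T : ℝ≥0, (⨆ (t : ℝ≥0) (_ : t ≤ T) (x : Space d), ∫⁻ ω, ‖u t x ω‖ₑ ∂P) < ∞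

end StableSHE

end

noncomputable section

namespace StableSHE

open Filter Topology ProbabilityTheory

/-! ### Positive definiteness of the stable characteristic exponent -/

/-! The equation is solved by Picard iteration in first moment. For a non-compensated Poisson
integral of a predictable integrand, Campbell's formula gives `E|∫ f dN| ≤ ∫ E|f| dμ`, with `μ` the
intensity. Applied to the difference of two mild integrands, the Lipschitz bound and `∫ J dν ≤ K`
leave `K * Lip` times the integral over `s` and `y` of `p(t-s, x-y) E|u - v|(s, y)`. The density `p`
is nonnegative with total mass one, so the spatial integral costs nothing, and `∫_0^t e^{bs} ds ≤
e^{bt} / b`. The mild map therefore contracts the norm `‖·‖_{1,b}` by the factor `lam * K * Lip / b`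
in every dimension, and any `b > lam * K * Lip` serves for existence and uniqueness. The carriers
are `lintegral_stableDensity`, `IsPoissonRandomMeasure.lintegral_lintegral_predictable` and
`lintegral_mild_sub_le`.

For `d = 1` the assumption on `β` says at least that `β > lam * K * Lip`: integrating the heat
kernel bound at time one gives `1 ≤ C(1,α) * 2(1+α)/α`, hence `C_{1,α,β} ≥ 1/β`.

Nonnegativity of `p` is subordination on the Fourier side. For `a = α/2 < 1`, `r^a` is an integral
of `1 - e^{-sr}` against a multiple of `s^{-1-a} ds`. Cutting off small `s` turns `exp(-t r^a)` into
a constant times the exponential of the Laplace transform of a finite measure, which is a limit of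
powers of Laplace transforms, that is, of Gaussian mixtures in `ξ` when `r = |ξ|^2`. Gaussians have
positive Fourier transforms, and a Gaussian regularization justifies all the limits.

Two measure-theoretic points remain. `N ω` is σ-finite only almost surely, so Fubini arguments use a
kernel modified on a null event. Predictability of the mild map is obtained by integrating over
times strictly before `t`, which almost surely changes nothing at a fixed `t`. -/

theorem integral_cos_mul_gaussian {d : ℕ} {b : ℝ} (hb : 0 < b) (x : Space d) :
    ∫ ξ : Space d, Real.cos (inner ℝ x ξ) * Real.exp (-(b * ‖ξ‖ ^ 2)) =
      (Real.pi / b) ^ ((d : ℝ) / 2) * Real.exp (-(‖x‖ ^ 2 / (4 * b))) := by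
  have hb' : 0 < (b : ℂ).re := by simpa using hb
  have h := GaussianFourier.integral_cexp_neg_mul_sq_norm_add hb' Complex.I x
  have hi := GaussianFourier.integrable_cexp_neg_mul_sq_norm_add hb' Complex.I x
  have h2 := integral_re (𝕜 := ℂ) hi
  rw [h] at h2
  have e1 : ∀ ξ : Space d, RCLike.re (Complex.exp (-(b : ℂ) * (‖ξ‖ : ℂ) ^ 2 +
      Complex.I * (inner ℝ x ξ : ℝ))) =
      Real.cos (inner ℝ x ξ) * Real.exp (-(b * ‖ξ‖ ^ 2)) := by
    intro ξ
    have : -(b : ℂ) * (‖ξ‖ : ℂ) ^ 2 + Complex.I * (inner ℝ x ξ : ℝ) =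
      ((-(b * ‖ξ‖ ^ 2) : ℝ) : ℂ) + ((inner ℝ x ξ : ℝ) : ℂ) * Complex.I := by push_cast; ring
    rw [this]
    change (Complex.exp _).re = _
    rw [Complex.exp_re]
    simp only [Complex.add_re, Complex.add_im, Complex.ofReal_re, Complex.ofReal_im,
      Complex.re_ofReal_mul, Complex.im_ofReal_mul, Complex.I_re, Complex.I_im, mul_zero, mul_one,
      add_zero, zero_add]
    rw [mul_comm]
  have e2 : ((Real.pi : ℂ) / b) ^ ((Module.finrank ℝ (Space d) : ℂ) / 2) *
      Complex.exp (Complex.I ^ 2 * (‖x‖ : ℂ) ^ 2 / (4 * b)) =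
      (((Real.pi / b) ^ ((d : ℝ) / 2) * Real.exp (-(‖x‖ ^ 2 / (4 * b))) : ℝ) : ℂ) := by
    rw [Complex.ofReal_mul, Complex.ofReal_cpow (by positivity)]
    push_cast
    simp only [finrank_euclideanSpace, Fintype.card_fin, Complex.I_sq]
    congr 2
    ring
  simp only [e1] at h2
  rw [h2, e2]
  exact Complex.ofReal_re _

theorem integrable_gaussian {d : ℕ} {b : ℝ} (hb : 0 < b) :
    Integrable (fun ξ : Space d => Real.exp (-(b * ‖ξ‖ ^ 2))) := by
  have hb' : 0 < (b : ℂ).re := by simpa using hb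
  have hi := (GaussianFourier.integrable_cexp_neg_mul_sq_norm_add (V := Space d) hb' 0 0).norm
  refine hi.congr (Eventually.of_forall fun ξ => ?_)
  simp only [Complex.norm_exp]
  congr 1
  have : -(b : ℂ) * (‖ξ‖ : ℂ) ^ 2 + 0 * ((inner ℝ (0 : Space d) ξ : ℝ) : ℂ) =
      ((-(b * ‖ξ‖ ^ 2) : ℝ) : ℂ) := by push_cast; ring
  rw [this, Complex.ofReal_re]

/-- The radial function `ξ ↦ F (‖ξ‖²)` has, after every Gaussian regularization, a nonnegative
Fourier transform. -/
def GaussPos (d : ℕ) (F : ℝ → ℝ) : Prop :=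
  ∀ δ : ℝ, 0 < δ → ∀ x : Space d,
    0 ≤ ∫ ξ : Space d, Real.cos (inner ℝ x ξ) * (F (‖ξ‖ ^ 2) * Real.exp (-(δ * ‖ξ‖ ^ 2)))

namespace GaussPos

variable {d : ℕ}

theorem one : GaussPos d (fun _ => 1) := by
  intro δ hδ x
  simp only [one_mul]
  rw [integral_cos_mul_gaussian hδ]
  positivity

theorem const_mul {F : ℝ → ℝ} (hF : GaussPos d F) {c : ℝ} (hc : 0 ≤ c) :
    GaussPos d (fun r => c * F r) := by
  intro δ hδ x
  have : ∀ ξ : Space d, Real.cos (inner ℝ x ξ) * (c * F (‖ξ‖ ^ 2) * Real.exp (-(δ * ‖ξ‖ ^ 2))) =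
      c * (Real.cos (inner ℝ x ξ) * (F (‖ξ‖ ^ 2) * Real.exp (-(δ * ‖ξ‖ ^ 2)))) := by
    intro ξ; ring
  simp only [this]
  rw [integral_const_mul]
  exact mul_nonneg hc (hF δ hδ x)

/-- The Gaussian factor supplies the dominating function, so a uniform bound on the approximants
suffices and no decay of `F` is needed. -/
theorem of_tendsto {F : ℝ → ℝ} {f : ℕ → ℝ → ℝ} (hf : ∀ n, GaussPos d (f n))
    (hm : ∀ n, Measurable (f n)) {B : ℝ} (hB : ∀ n r, 0 ≤ r → |f n r| ≤ B)
    (hlim : ∀ r, 0 ≤ r → Tendsto (fun n => f n r) atTop (𝓝 (F r))) : GaussPos d F := by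
  intro δ hδ x
  refine ge_of_tendsto' (tendsto_integral_of_dominated_convergence
    (F := fun n (ξ : Space d) => Real.cos (inner ℝ x ξ) *
      (f n (‖ξ‖ ^ 2) * Real.exp (-(δ * ‖ξ‖ ^ 2))))
    (fun ξ : Space d => B * Real.exp (-(δ * ‖ξ‖ ^ 2))) (fun n => ?_)
    ((integrable_gaussian hδ).const_mul B) (fun n => ?_) ?_) fun n => hf n δ hδ x
  · have := hm n
    exact Measurable.aestronglyMeasurable (by fun_prop)
  · refine Eventually.of_forall fun ξ => ?_
    rw [norm_mul, norm_mul, Real.norm_eq_abs, Real.norm_eq_abs, Real.norm_eq_abs,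
      abs_of_pos (Real.exp_pos _)]
    have h1 := Real.abs_cos_le_one (inner ℝ x ξ)
    have h2 := hB n (‖ξ‖ ^ 2) (by positivity)
    calc _ ≤ 1 * (|f n (‖ξ‖ ^ 2)| * Real.exp (-(δ * ‖ξ‖ ^ 2))) := by gcongr
      _ ≤ _ := by rw [one_mul]; gcongr
  · refine Eventually.of_forall fun ξ => ?_
    exact ((hlim _ (by positivity)).mul_const _).const_mul _

/-- Since `e^{-sr} e^{-δr} = e^{-(s+δ)r}`, the Laplace variable only shifts the regularization
parameter. After Fubini the integral is an average over `s` of quantities that are nonnegative by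
`hF` at `s + δ`. -/
theorem laplace_mul {F : ℝ → ℝ} (hF : GaussPos d F) (hm : Measurable F) {B : ℝ}
    (hB : ∀ r, 0 ≤ r → |F r| ≤ B) (m : Measure ℝ) [IsFiniteMeasure m] (hpos : ∀ᵐ s ∂m, 0 ≤ s) :
    GaussPos d (fun r => (∫ s, Real.exp (-(s * r)) ∂m) * F r) := by
  intro δ hδ x
  have e1 : ∀ ξ : Space d, Real.cos (inner ℝ x ξ) * ((∫ s, Real.exp (-(s * ‖ξ‖ ^ 2)) ∂m) *
      F (‖ξ‖ ^ 2) * Real.exp (-(δ * ‖ξ‖ ^ 2))) =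
      ∫ s, Real.cos (inner ℝ x ξ) * (F (‖ξ‖ ^ 2) * Real.exp (-((s + δ) * ‖ξ‖ ^ 2))) ∂m := by
    intro ξ
    have : ∀ s : ℝ, Real.cos (inner ℝ x ξ) * (F (‖ξ‖ ^ 2) * Real.exp (-((s + δ) * ‖ξ‖ ^ 2))) =
      (Real.cos (inner ℝ x ξ) * (F (‖ξ‖ ^ 2) * Real.exp (-(δ * ‖ξ‖ ^ 2)))) *
        Real.exp (-(s * ‖ξ‖ ^ 2)) := by
      intro s
      rw [add_mul, neg_add, Real.exp_add]; ring
    simp only [this]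
    rw [integral_const_mul]; ring
  simp only [e1]
  rw [integral_integral_swap]
  · refine integral_nonneg_of_ae ?_
    filter_upwards [hpos] with s hs
    exact hF (s + δ) (by linarith) x
  · have hint : Integrable (fun z : Space d × ℝ => B * Real.exp (-(δ * ‖z.1‖ ^ 2)))
        ((volume : Measure (Space d)).prod m) :=
      ((integrable_gaussian hδ).const_mul B).comp_fst m
    refine hint.mono' (Measurable.aestronglyMeasurable ?_) ?_
    · simp only [Function.uncurry_def]
      fun_prop
    · have : ∀ᵐ z ∂((volume : Measure (Space d)).prod m), 0 ≤ z.2 :=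
        Measure.quasiMeasurePreserving_snd.ae hpos
      filter_upwards [this] with z hz
      simp only [Function.uncurry_def]
      rw [norm_mul, norm_mul, Real.norm_eq_abs, Real.norm_eq_abs, Real.norm_eq_abs,
        abs_of_pos (Real.exp_pos _)]
      have h1 := Real.abs_cos_le_one (inner ℝ x z.1)
      have h2 := hB (‖z.1‖ ^ 2) (by positivity)
      have h3 : Real.exp (-((z.2 + δ) * ‖z.1‖ ^ 2)) ≤ Real.exp (-(δ * ‖z.1‖ ^ 2)) := by
        apply Real.exp_le_exp.2
        nlinarith [mul_nonneg hz (sq_nonneg ‖z.1‖)]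
      calc _ ≤ 1 * (|F (‖z.1‖ ^ 2)| * Real.exp (-((z.2 + δ) * ‖z.1‖ ^ 2))) := by gcongr
        _ ≤ _ := by rw [one_mul]; gcongr; exact (abs_nonneg _).trans h2

end GaussPos

theorem laplace_le {m : Measure ℝ} [IsFiniteMeasure m] (hpos : ∀ᵐ s ∂m, 0 ≤ s) {r : ℝ}
    (hr : 0 ≤ r) : ∫ s, Real.exp (-(s * r)) ∂m ≤ m.real univ := by
  have : ∫ s, Real.exp (-(s * r)) ∂m ≤ ∫ _, (1 : ℝ) ∂m := by
    refine integral_mono_of_nonneg (Eventually.of_forall fun s => (Real.exp_pos _).le)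
      (integrable_const 1) ?_
    filter_upwards [hpos] with s hs
    exact Real.exp_le_one_iff.2 (by nlinarith [mul_nonneg hs hr])
  simpa using this

theorem integrable_laplace {m : Measure ℝ} [IsFiniteMeasure m] (hpos : ∀ᵐ s ∂m, 0 ≤ s) {r : ℝ}
    (hr : 0 ≤ r) : Integrable (fun s => Real.exp (-(s * r))) m := by
  refine (integrable_const (1 : ℝ)).mono' (Measurable.aestronglyMeasurable (by fun_prop)) ?_
  filter_upwards [hpos] with s hs
  rw [Real.norm_eq_abs, abs_of_pos (Real.exp_pos _)]
  exact Real.exp_le_one_iff.2 (by nlinarith [mul_nonneg hs hr])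

theorem measurable_laplace (m : Measure ℝ) [IsFiniteMeasure m] :
    Measurable (fun r => ∫ s, Real.exp (-(s * r)) ∂m) := by
  have : StronglyMeasurable (Function.uncurry fun (r s : ℝ) => Real.exp (-(s * r))) :=
    Measurable.stronglyMeasurable (by simp only [Function.uncurry_def]; fun_prop)
  exact this.integral_prod_right.measurable

theorem GaussPos.laplace_pow {d : ℕ} (m : Measure ℝ) [IsFiniteMeasure m]
    (hpos : ∀ᵐ s ∂m, 0 ≤ s) (n : ℕ) :
    GaussPos d (fun r => (∫ s, Real.exp (-(s * r)) ∂m) ^ n) := by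
  induction n with
  | zero => simpa using GaussPos.one
  | succ n ih =>
    simp only [pow_succ']
    refine ih.laplace_mul ((measurable_laplace m).pow_const n) (B := m.real univ ^ n)
      (fun r hr => ?_) m hpos
    have h0 : 0 ≤ ∫ s, Real.exp (-(s * r)) ∂m := integral_nonneg fun s => (Real.exp_pos _).le
    rw [abs_of_nonneg (by positivity)]
    have := laplace_le hpos hr
    gcongr

/-- Writing `G` for the Laplace transform of `m`, `e^G` is the limit of `(1 + G/n)^n`, a power of a
single Laplace transform, and all these are bounded by `e^{m(ℝ)}`. -/
theorem GaussPos.exp_laplace {d : ℕ} (m : Measure ℝ) [IsFiniteMeasure m]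
    (hpos : ∀ᵐ s ∂m, 0 ≤ s) : GaussPos d (fun r => Real.exp (∫ s, Real.exp (-(s * r)) ∂m)) := by
  set G : ℝ → ℝ := fun r => ∫ s, Real.exp (-(s * r)) ∂m with hG
  have hG0 : ∀ r, 0 ≤ G r := fun r => integral_nonneg fun s => (Real.exp_pos _).le
  have key : ∀ n : ℕ, GaussPos d (fun r => if 0 ≤ r then (1 + G r / n) ^ n else 0) := by
    intro n δ hδ x
    -- The unit mass at `0` contributes the `1` in `1 + G/n`. For `n = 0` both sides are zeroth
    -- powers.
    set m' : Measure ℝ := Measure.dirac 0 + (n : ℝ≥0)⁻¹ • m with hm'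
    have hp' : ∀ᵐ s ∂m', 0 ≤ s := by
      rw [hm', ae_add_measure_iff]
      refine ⟨by rw [ae_dirac_iff measurableSet_Ici], Measure.ae_smul_measure hpos _⟩
    have := GaussPos.laplace_pow (d := d) m' hp' n δ hδ x
    refine this.trans_eq (integral_congr_ae (Eventually.of_forall fun ξ => ?_))
    have hξ : (0 : ℝ) ≤ ‖ξ‖ ^ 2 := by positivity
    simp only [hξ, if_true]
    congr 3
    rw [hm', integral_add_measure (integrable_dirac (by simp))
      ((integrable_laplace hpos hξ).smul_measure_nnreal), integral_dirac,
      integral_smul_nnreal_measure]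
    simp [hG, NNReal.smul_def, div_eq_inv_mul]
  refine GaussPos.of_tendsto key (fun n => ?_) (B := Real.exp (m.real univ)) (fun n r hr => ?_)
    (fun r hr => ?_)
  · exact Measurable.ite measurableSet_Ici
      ((((measurable_laplace m).div_const _).const_add 1).pow_const n) measurable_const
  · simp only [hr, if_true]
    have h1 : 0 ≤ G r / n := div_nonneg (hG0 r) (by positivity)
    rw [abs_of_nonneg (by positivity)]
    have h2 : 1 + G r / n ≤ Real.exp (G r / n) := by
      have := Real.add_one_le_exp (G r / n); linarith
    calc (1 + G r / n) ^ n ≤ Real.exp (G r / n) ^ n := by gcongr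
      _ = Real.exp (n * (G r / n)) := by rw [← Real.exp_nat_mul]
      _ ≤ Real.exp (m.real univ) := by
          apply Real.exp_le_exp.2
          rcases Nat.eq_zero_or_pos n with rfl | hn
          · simp
          · rw [mul_div_cancel₀ _ (by positivity)]; exact laplace_le hpos hr
  · simp only [hr, if_true]
    exact Real.tendsto_one_add_div_pow_exp (G r)

/-- Near `0` the integrand is at most `r s^{-a}`, integrable because `a < 1`; beyond `1` it is at
most `s^{-1-a}`, integrable because `a > 0`. -/
theorem integrableOn_one_sub_exp_mul_rpow {a : ℝ} (h0 : 0 < a) (h1 : a < 1) {r : ℝ}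
    (hr : 0 ≤ r) :
    IntegrableOn (fun s : ℝ => (1 - Real.exp (-(s * r))) * s ^ (-1 - a)) (Ioi 0) := by
  have hmeas : Measurable (fun s : ℝ => (1 - Real.exp (-(s * r))) * s ^ (-1 - a)) := by fun_prop
  have hsplit : Ioi (0 : ℝ) = Ioc 0 1 ∪ Ioi 1 := (Ioc_union_Ioi_eq_Ioi zero_le_one).symm
  rw [hsplit]
  refine IntegrableOn.union ?_ ?_
  · have hi : IntegrableOn (fun s : ℝ => r * s ^ (-a)) (Ioc 0 1) :=
      ((intervalIntegral.intervalIntegrable_rpow' (a := 0) (b := 1) (r := -a)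
        (by linarith)).1).const_mul r
    refine hi.mono' hmeas.aestronglyMeasurable ?_
    refine (ae_restrict_mem measurableSet_Ioc).mono fun s hs => ?_
    have hs0 : 0 < s := hs.1
    have hsr : 0 ≤ s * r := by positivity
    have h2 : 1 - Real.exp (-(s * r)) ≤ s * r := by
      have := Real.add_one_le_exp (-(s * r)); linarith
    have h3 : 0 ≤ 1 - Real.exp (-(s * r)) := by
      have := Real.exp_le_one_iff.2 (neg_nonpos.2 hsr); linarith
    have hp : (0 : ℝ) < s ^ (-1 - a) := by positivity
    rw [Real.norm_eq_abs, abs_of_nonneg (by positivity)]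
    calc _ ≤ s * r * s ^ (-1 - a) := by gcongr
      _ = r * s ^ (-a) := by
        have : s ^ (-a) = s ^ (-1 - a) * s := by
          rw [← Real.rpow_add_one hs0.ne']; congr 1; ring
        rw [this]; ring
  · refine (integrableOn_Ioi_rpow_of_lt (a := -1 - a) (by linarith) one_pos).mono'
      hmeas.aestronglyMeasurable ?_
    refine (ae_restrict_mem measurableSet_Ioi).mono fun s hs => ?_
    have hs0 : 0 < s := zero_lt_one.trans hs
    have hsr : 0 ≤ s * r := by positivity
    have h3 : 0 ≤ 1 - Real.exp (-(s * r)) := by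
      have := Real.exp_le_one_iff.2 (neg_nonpos.2 hsr); linarith
    have h4 : 1 - Real.exp (-(s * r)) ≤ 1 := by linarith [Real.exp_pos (-(s * r))]
    have hp : (0 : ℝ) < s ^ (-1 - a) := by positivity
    rw [Real.norm_eq_abs, abs_of_nonneg (by positivity)]
    exact mul_le_of_le_one_left hp.le h4

/-- The substitution `s ↦ rs` shows that the integral scales as `I(r) = r^a I(1)`, so `c = 1 /
I(1)`. -/
theorem exists_rpow_eq_integral {a : ℝ} (h0 : 0 < a) (h1 : a < 1) :
    ∃ c : ℝ, 0 < c ∧ ∀ r : ℝ, 0 ≤ r →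
      r ^ a = ∫ s in Ioi (0 : ℝ), c * ((1 - Real.exp (-(s * r))) * s ^ (-1 - a)) := by
  set I : ℝ → ℝ := fun r => ∫ s in Ioi (0 : ℝ), (1 - Real.exp (-(s * r))) * s ^ (-1 - a) with hI
  have hI1 : 0 < I 1 := by
    rw [hI]
    simp only
    rw [setIntegral_pos_iff_support_of_nonneg_ae]
    · have : Ioi (0 : ℝ) ⊆ Function.support
          (fun s : ℝ => (1 - Real.exp (-(s * 1))) * s ^ (-1 - a)) ∩ Ioi 0 := by
        intro s hs
        have hs0 : 0 < s := hs
        refine ⟨?_, hs⟩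
        have : Real.exp (-(s * 1)) < 1 := Real.exp_lt_one_iff.2 (by linarith)
        have hp : (0 : ℝ) < s ^ (-1 - a) := by positivity
        exact (mul_pos (by linarith) hp).ne'
      refine lt_of_lt_of_le ?_ (measure_mono this)
      simp
    · refine (ae_restrict_mem measurableSet_Ioi).mono fun s hs => ?_
      have hs0 : 0 < s := hs
      have : Real.exp (-(s * 1)) < 1 := Real.exp_lt_one_iff.2 (by linarith)
      have hp : (0 : ℝ) < s ^ (-1 - a) := by positivity
      exact (mul_pos (by linarith) hp).le
    · exact integrableOn_one_sub_exp_mul_rpow h0 h1 zero_le_one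
  refine ⟨(I 1)⁻¹, inv_pos.2 hI1, fun r hr => ?_⟩
  rw [integral_const_mul]
  change r ^ a = (I 1)⁻¹ * I r
  rcases hr.eq_or_lt with rfl | hr
  · simp [hI, Real.zero_rpow h0.ne']
  · have h := integral_comp_mul_left_Ioi
      (fun u : ℝ => (1 - Real.exp (-(u * 1))) * u ^ (-1 - a)) 0 hr
    rw [mul_zero] at h
    have e : ∫ x in Ioi (0 : ℝ), (1 - Real.exp (-(r * x * 1))) * (r * x) ^ (-1 - a) =
        r ^ (-1 - a) * I r := by
      rw [hI]
      simp only
      rw [← integral_const_mul]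
      refine setIntegral_congr_fun measurableSet_Ioi fun s hs => ?_
      have hs0 : 0 < s := hs
      rw [Real.mul_rpow hr.le hs0.le, mul_one, mul_comm r s]; ring
    rw [e, smul_eq_mul] at h
    have hra : r ^ a * r ^ (-1 - a) = r⁻¹ := by
      rw [← Real.rpow_add hr, ← Real.rpow_neg_one]; congr 1; ring
    have hp : (0 : ℝ) < r ^ (-1 - a) := by positivity
    have : r ^ (-1 - a) * (I r) = r ^ (-1 - a) * (r ^ a * I 1) := by
      rw [h, ← mul_assoc, mul_comm (r ^ (-1 - a)), hra]
    rw [mul_left_cancel₀ hp.ne' this]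
    field_simp

/-- For `a = 1` the function is itself a Gaussian. For `a < 1` the integral representing `r^a` is
cut off at `ε n`, and the cutoff is then removed by a limit. -/
theorem GaussPos.exp_neg_rpow {d : ℕ} {a t : ℝ} (h0 : 0 < a) (h1 : a ≤ 1) (ht : 0 < t) :
    GaussPos d (fun r => Real.exp (-(t * r ^ a))) := by
  rcases h1.eq_or_lt with rfl | h1
  · intro δ hδ x
    have := GaussPos.one (d := d) (t + δ) (by positivity) x
    refine this.trans_eq (integral_congr_ae (Eventually.of_forall fun ξ => ?_))
    simp only [Real.rpow_one]
    rw [← Real.exp_add, one_mul, add_mul, neg_add]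
  · obtain ⟨c, hc, hrep⟩ := exists_rpow_eq_integral h0 h1
    set ε : ℕ → ℝ := fun n => 1 / ((n : ℝ) + 1) with hε
    have hεpos : ∀ n, 0 < ε n := fun n => Nat.one_div_pos_of_nat
    set g : ℝ → ℝ → ℝ := fun r s => c * ((1 - Real.exp (-(s * r))) * s ^ (-1 - a)) with hg
    have hgi : ∀ r, 0 ≤ r → IntegrableOn (g r) (Ioi 0) := fun r hr =>
      (integrableOn_one_sub_exp_mul_rpow h0 h1 hr).const_mul c
    have hgm : Measurable (Function.uncurry g) := by
      simp only [hg, Function.uncurry_def]; fun_prop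
    have key : ∀ n, GaussPos d (fun r => Real.exp (-(t * ∫ s in Ioi (ε n), g r s))) := by
      intro n
      set w : ℝ → ℝ≥0∞ := fun s => ENNReal.ofReal (t * c * s ^ (-1 - a)) with hw
      have hwm : Measurable w := by fun_prop
      -- Beyond the cutoff `t c s^{-1-a} ds` is finite, so `1` and `e^{-sr}` can be integrated
      -- separately: the first gives the constant factor in `e0`, the second the Laplace transform
      -- of `m`.
      set m : Measure ℝ := (volume.restrict (Ioi (ε n))).withDensity w with hm
      have hri : IntegrableOn (fun s : ℝ => s ^ (-1 - a)) (Ioi (ε n)) :=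
        integrableOn_Ioi_rpow_of_lt (by linarith) (hεpos n)
      have : IsFiniteMeasure m := by
        refine isFiniteMeasure_withDensity ?_
        exact ((hri.const_mul (t * c)).lintegral_lt_top).ne
      have hpos : ∀ᵐ s ∂m, 0 ≤ s := by
        refine (withDensity_absolutelyContinuous _ _).ae_le ?_
        exact (ae_restrict_mem measurableSet_Ioi).mono fun s hs => ((hεpos n).trans hs).le
      have e0 := GaussPos.const_mul (GaussPos.exp_laplace (d := d) m hpos)
        (c := Real.exp (-(t * c * ∫ s in Ioi (ε n), s ^ (-1 - a)))) (Real.exp_pos _).le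
      intro δ hδ x
      refine (e0 δ hδ x).trans_eq (integral_congr_ae (Eventually.of_forall fun ξ => ?_))
      simp only
      congr 2
      have hξ : (0 : ℝ) ≤ ‖ξ‖ ^ 2 := by positivity
      rw [← Real.exp_add]
      congr 1
      rw [hm, integral_withDensity_eq_integral_toReal_smul hwm
        (Eventually.of_forall fun s => ENNReal.ofReal_lt_top)]
      have e1 : ∫ s in Ioi (ε n), (w s).toReal • Real.exp (-(s * ‖ξ‖ ^ 2)) =
          t * c * ∫ s in Ioi (ε n), s ^ (-1 - a) * Real.exp (-(s * ‖ξ‖ ^ 2)) := by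
        rw [← integral_const_mul]
        refine setIntegral_congr_fun measurableSet_Ioi fun s hs => ?_
        have hs0 : 0 < s := (hεpos n).trans hs
        simp only [hw, smul_eq_mul]
        rw [ENNReal.toReal_ofReal (by positivity), mul_assoc]
      have hi2 : IntegrableOn (fun s : ℝ => s ^ (-1 - a) * Real.exp (-(s * ‖ξ‖ ^ 2)))
          (Ioi (ε n)) := by
        refine hri.mono' (Measurable.aestronglyMeasurable (by fun_prop)) ?_
        refine (ae_restrict_mem measurableSet_Ioi).mono fun s hs => ?_
        have hs0 : 0 < s := (hεpos n).trans hs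
        have hp : (0 : ℝ) < s ^ (-1 - a) := by positivity
        rw [Real.norm_eq_abs, abs_of_pos (by positivity)]
        exact mul_le_of_le_one_right hp.le (Real.exp_le_one_iff.2 (by
          nlinarith [mul_nonneg hs0.le hξ]))
      have e2 : ∫ s in Ioi (ε n), g (‖ξ‖ ^ 2) s = c * ((∫ s in Ioi (ε n), s ^ (-1 - a)) -
          ∫ s in Ioi (ε n), s ^ (-1 - a) * Real.exp (-(s * ‖ξ‖ ^ 2))) := by
        rw [← integral_sub hri hi2, ← integral_const_mul]
        refine integral_congr_ae (Eventually.of_forall fun s => ?_)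
        simp only [hg]; ring
      rw [e1, e2]; ring
    refine GaussPos.of_tendsto key (fun n => ?_) (B := 1) (fun n r hr => ?_) (fun r hr => ?_)
    · have := hgm.stronglyMeasurable.integral_prod_right (ν := volume.restrict (Ioi (ε n)))
      have := this.measurable
      fun_prop
    · rw [abs_of_pos (Real.exp_pos _)]
      refine Real.exp_le_one_iff.2 (neg_nonpos.2 (mul_nonneg ht.le
        (setIntegral_nonneg measurableSet_Ioi fun s hs => ?_)))
      have hs0 : 0 < s := (hεpos n).trans hs
      have : Real.exp (-(s * r)) ≤ 1 := Real.exp_le_one_iff.2 (by nlinarith [mul_nonneg hs0.le hr])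
      have hp : (0 : ℝ) < s ^ (-1 - a) := by positivity
      exact mul_nonneg hc.le (mul_nonneg (by linarith) hp.le)
    · have hU : ⋃ n, Ioi (ε n) = Ioi (0 : ℝ) := by
        ext s
        simp only [mem_iUnion, mem_Ioi]
        exact ⟨fun ⟨n, hn⟩ => (hεpos n).trans hn, fun hs => exists_nat_one_div_lt hs⟩
      have := tendsto_setIntegral_of_monotone (f := g r) (μ := volume) (s := fun n => Ioi (ε n))
        (fun n => measurableSet_Ioi)
        (fun i j hij => Ioi_subset_Ioi (Nat.one_div_le_one_div hij)) (hU ▸ hgi r hr)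
      rw [hU, ← hrep r hr] at this
      exact (Real.continuous_exp.tendsto _).comp ((this.const_mul t).neg)

/-! ### The stable density is a probability density -/

section Density

variable {d : ℕ} {α : ℝ}

theorem norm_rpow_eq_sq_rpow (α : ℝ) (ξ : Space d) : ‖ξ‖ ^ α = (‖ξ‖ ^ 2) ^ (α / 2) := by
  rw [← Real.rpow_natCast, ← Real.rpow_mul (norm_nonneg _)]
  congr 1; push_cast; ring

theorem integrable_exp_neg_mul_norm_rpow (hd : 0 < d) (hα : 0 < α) {t : ℝ} (ht : 0 < t) :
    Integrable (fun ξ : Space d => Real.exp (-(t * ‖ξ‖ ^ α))) := by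
  have : Nonempty (Fin d) := ⟨⟨0, hd⟩⟩
  have : Nontrivial (Space d) := inferInstance
  refine (integrable_fun_norm_addHaar (volume : Measure (Space d))
    (f := fun r : ℝ => Real.exp (-(t * r ^ α)))).2 ?_
  have h := integrableOn_rpow_mul_exp_neg_mul_rpow (p := α) (s := ((d - 1 : ℕ) : ℝ)) (b := t)
    (by have : (0 : ℝ) ≤ ((d - 1 : ℕ) : ℝ) := by positivity
        linarith) hα ht
  refine h.congr_fun (fun y hy => ?_) measurableSet_Ioi
  simp [Real.rpow_natCast]

theorem measurable_stableDensity (d : ℕ) (α : ℝ) :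
    Measurable (fun q : ℝ × Space d => stableDensity α q.1 q.2) := by
  have : StronglyMeasurable (Function.uncurry fun (q : ℝ × Space d) (ξ : Space d) =>
      Real.cos (inner ℝ q.2 ξ) * Real.exp (-(q.1 * ‖ξ‖ ^ α))) :=
    Measurable.stronglyMeasurable (by simp only [Function.uncurry_def]; fun_prop)
  exact this.integral_prod_right.measurable.const_mul _

theorem measurable_stableDensity_right (d : ℕ) (α t : ℝ) :
    Measurable (fun x : Space d => stableDensity α t x) :=
  Measurable.of_uncurry_left (f := fun (t : ℝ) (x : Space d) => stableDensity α t x)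
    (measurable_stableDensity d α)

/-- `GaussPos.exp_neg_rpow` with exponent `α/2 ≤ 1` handles the regularized inversion integral;
letting the regularization tend to zero is dominated by `e^{-t|ξ|^α}`. -/
theorem stableDensity_nonneg (hd : 0 < d) (hα : 0 < α) (hα2 : α ≤ 2) {t : ℝ} (ht : 0 < t)
    (x : Space d) : 0 ≤ stableDensity α t x := by
  refine mul_nonneg (by positivity) ?_
  refine ge_of_tendsto' (tendsto_integral_of_dominated_convergence
    (F := fun (n : ℕ) (ξ : Space d) => Real.cos (inner ℝ x ξ) *
      (Real.exp (-(t * (‖ξ‖ ^ 2) ^ (α / 2))) *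
        Real.exp (-((1 / ((n : ℝ) + 1)) * ‖ξ‖ ^ 2))))
    (fun ξ : Space d => Real.exp (-(t * ‖ξ‖ ^ α))) (fun n => ?_)
    (integrable_exp_neg_mul_norm_rpow hd hα ht) (fun n => ?_) ?_) fun n =>
      GaussPos.exp_neg_rpow (by positivity) (by linarith) ht _ Nat.one_div_pos_of_nat x
  · exact Measurable.aestronglyMeasurable (by fun_prop)
  · refine Eventually.of_forall fun ξ => ?_
    rw [← norm_rpow_eq_sq_rpow, norm_mul, norm_mul, Real.norm_eq_abs, Real.norm_eq_abs,
      Real.norm_eq_abs, abs_of_pos (Real.exp_pos _), abs_of_pos (Real.exp_pos _)]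
    have h1 := Real.abs_cos_le_one (inner ℝ x ξ)
    have h2 : Real.exp (-((1 / ((n : ℝ) + 1)) * ‖ξ‖ ^ 2)) ≤ 1 :=
      Real.exp_le_one_iff.2 (neg_nonpos.2 (by positivity))
    calc _ ≤ 1 * (Real.exp (-(t * ‖ξ‖ ^ α)) * 1) := by gcongr
      _ = _ := by ring
  · refine Eventually.of_forall fun ξ => ?_
    refine Tendsto.const_mul _ ?_
    rw [norm_rpow_eq_sq_rpow]
    have h := (tendsto_one_div_add_atTop_nhds_zero_nat (𝕜 := ℝ)).mul_const (‖ξ‖ ^ 2)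
    have h2 := ((Real.continuous_exp.tendsto _).comp h.neg).const_mul
      (Real.exp (-(t * (‖ξ‖ ^ 2) ^ (α / 2))))
    simpa using h2

theorem abs_stableDensity_le (hd : 0 < d) (hα : 0 < α) {t : ℝ} (ht : 0 < t) (x : Space d) :
    |stableDensity α t x| ≤
      ((2 * Real.pi) ^ d)⁻¹ * ∫ ξ : Space d, Real.exp (-(t * ‖ξ‖ ^ α)) := by
  rw [stableDensity, abs_mul, abs_of_pos (by positivity : 0 < ((2 * Real.pi) ^ d)⁻¹)]
  gcongr
  rw [← Real.norm_eq_abs]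
  refine norm_integral_le_of_norm_le (integrable_exp_neg_mul_norm_rpow hd hα ht)
    (Eventually.of_forall fun ξ => ?_)
  rw [norm_mul, Real.norm_eq_abs, Real.norm_eq_abs, abs_of_pos (Real.exp_pos _)]
  exact mul_le_of_le_one_left (Real.exp_pos _).le (Real.abs_cos_le_one _)

theorem integrable_stableDensity_mul_gaussian (hd : 0 < d) (hα : 0 < α) {t δ : ℝ} (ht : 0 < t)
    (hδ : 0 < δ) :
    Integrable (fun x : Space d => stableDensity α t x * Real.exp (-(δ * ‖x‖ ^ 2))) := by
  have key : ∀ (p : Space d → ℝ) (B : ℝ), Measurable p → (∀ x, ‖p x‖ ≤ B) →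
      Integrable (fun x => p x * Real.exp (-(δ * ‖x‖ ^ 2))) := fun p B hm hb =>
    (integrable_gaussian hδ).bdd_mul hm.aestronglyMeasurable (Eventually.of_forall hb)
  exact key _ _ (measurable_stableDensity_right d α t) (abs_stableDensity_le hd hα ht)

/-- Fubini moves the Fourier transform onto the Gaussian, and the substitution `ξ = √δ η` makes the
factor `(π/δ)^{d/2}` cancel against the Jacobian. On the right `δ` survives only where it can be
sent to `0`. -/
theorem integral_stableDensity_mul_gaussian (hd : 0 < d) (hα : 0 < α) {t δ : ℝ} (ht : 0 < t)
    (hδ : 0 < δ) :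
    ∫ x : Space d, stableDensity α t x * Real.exp (-(δ * ‖x‖ ^ 2)) =
      ((2 * Real.pi) ^ d)⁻¹ * (Real.pi ^ ((d : ℝ) / 2) *
        ∫ η : Space d, Real.exp (-(t * ‖√δ • η‖ ^ α)) * Real.exp (-(1 / 4 * ‖η‖ ^ 2))) := by
  have e1 : ∀ x : Space d, stableDensity α t x * Real.exp (-(δ * ‖x‖ ^ 2)) =
      ((2 * Real.pi) ^ d)⁻¹ * ∫ ξ : Space d, Real.exp (-(t * ‖ξ‖ ^ α)) *
        (Real.cos (inner ℝ ξ x) * Real.exp (-(δ * ‖x‖ ^ 2))) := by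
    intro x
    rw [stableDensity, mul_assoc, ← integral_mul_const]
    congr 2
    ext ξ
    rw [real_inner_comm]; ring
  simp only [e1]
  rw [integral_const_mul, integral_integral_swap]
  · congr 1
    simp only [integral_const_mul, integral_cos_mul_gaussian hδ]
    have h := Measure.integral_comp_smul (volume : Measure (Space d))
      (fun ξ : Space d => Real.exp (-(t * ‖ξ‖ ^ α)) * Real.exp (-(‖ξ‖ ^ 2 / (4 * δ)))) √δ
    have hs : 0 < √δ := Real.sqrt_pos.2 hδ
    have e2 : ∀ η : Space d, ‖√δ • η‖ ^ 2 / (4 * δ) = 1 / 4 * ‖η‖ ^ 2 := by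
      intro η
      rw [norm_smul, mul_pow, Real.norm_eq_abs, sq_abs, Real.sq_sqrt hδ.le]
      field_simp
    simp only [e2, finrank_euclideanSpace, Fintype.card_fin] at h
    rw [h, abs_of_pos (by positivity), smul_eq_mul]
    have e3 : (Real.pi / δ) ^ ((d : ℝ) / 2) = Real.pi ^ ((d : ℝ) / 2) * (√δ ^ d)⁻¹ := by
      rw [Real.div_rpow Real.pi_pos.le hδ.le, div_eq_mul_inv]
      congr 2
      rw [Real.sqrt_eq_rpow, ← Real.rpow_natCast, ← Real.rpow_mul hδ.le]
      congr 1; ring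
    rw [e3, ← mul_assoc, ← integral_const_mul]
    congr 1
    ext ξ
    ring
  · have hi := (integrable_gaussian (d := d) hδ).mul_prod
      (integrable_exp_neg_mul_norm_rpow hd hα ht)
    refine hi.mono' (Measurable.aestronglyMeasurable ?_) (Eventually.of_forall fun z => ?_)
    · simp only [Function.uncurry_def]; fun_prop
    · simp only [Function.uncurry_def]
      rw [norm_mul, norm_mul, Real.norm_eq_abs, Real.norm_eq_abs, Real.norm_eq_abs,
        abs_of_pos (Real.exp_pos _), abs_of_pos (Real.exp_pos _), mul_comm]
      have := Real.abs_cos_le_one (inner ℝ z.2 z.1)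
      gcongr
      exact mul_le_of_le_one_left (Real.exp_pos _).le this

/-- Let `δ → 0` in `integral_stableDensity_mul_gaussian`: monotone convergence on the left,
available because the density is nonnegative, and dominated convergence on the right. The constants
combine to `(2π)^{-d} π^{d/2} (4π)^{d/2} = 1`. -/
theorem lintegral_stableDensity (hd : 0 < d) (hα : 0 < α) (hα2 : α ≤ 2) {t : ℝ} (ht : 0 < t) :
    ∫⁻ x : Space d, ENNReal.ofReal (stableDensity α t x) = 1 := by
  set δ : ℕ → ℝ := fun n => 1 / ((n : ℝ) + 1) with hδ
  have hδpos : ∀ n, 0 < δ n := fun n => Nat.one_div_pos_of_nat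
  have hδlim : Tendsto δ atTop (𝓝 0) := tendsto_one_div_add_atTop_nhds_zero_nat
  have hm : Measurable (fun x : Space d => stableDensity α t x) :=
    measurable_stableDensity_right d α t
  have h1 : Tendsto (fun n => ∫⁻ x : Space d,
      ENNReal.ofReal (stableDensity α t x * Real.exp (-(δ n * ‖x‖ ^ 2)))) atTop
      (𝓝 (∫⁻ x : Space d, ENNReal.ofReal (stableDensity α t x))) := by
    refine lintegral_tendsto_of_tendsto_of_monotone (fun n => ?_)
      (Eventually.of_forall fun x i j hij => ?_) (Eventually.of_forall fun x => ?_)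
    · exact Measurable.aemeasurable (by fun_prop)
    · apply ENNReal.ofReal_le_ofReal
      have : δ j ≤ δ i := Nat.one_div_le_one_div hij
      have := stableDensity_nonneg hd hα hα2 ht x
      gcongr
    · refine (ENNReal.continuous_ofReal.tendsto _).comp ?_
      have h2 := ((Real.continuous_exp.tendsto _).comp
        (hδlim.mul_const (‖x‖ ^ 2)).neg).const_mul (stableDensity α t x)
      simpa using h2
  have h2 : ∀ n, ∫⁻ x : Space d,
      ENNReal.ofReal (stableDensity α t x * Real.exp (-(δ n * ‖x‖ ^ 2))) =
      ENNReal.ofReal (((2 * Real.pi) ^ d)⁻¹ * (Real.pi ^ ((d : ℝ) / 2) *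
        ∫ η : Space d, Real.exp (-(t * ‖√(δ n) • η‖ ^ α)) *
          Real.exp (-(1 / 4 * ‖η‖ ^ 2)))) := by
    intro n
    rw [← integral_stableDensity_mul_gaussian hd hα ht (hδpos n),
      ofReal_integral_eq_lintegral_ofReal
        (integrable_stableDensity_mul_gaussian hd hα ht (hδpos n))]
    exact Eventually.of_forall fun x =>
      mul_nonneg (stableDensity_nonneg hd hα hα2 ht x) (Real.exp_pos _).le
  have h3 : Tendsto (fun n => ∫ η : Space d, Real.exp (-(t * ‖√(δ n) • η‖ ^ α)) *
      Real.exp (-(1 / 4 * ‖η‖ ^ 2))) atTop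
      (𝓝 (∫ η : Space d, Real.exp (-(1 / 4 * ‖η‖ ^ 2)))) := by
    refine tendsto_integral_of_dominated_convergence
      (fun η : Space d => Real.exp (-(1 / 4 * ‖η‖ ^ 2))) (fun n => ?_)
      (integrable_gaussian (by norm_num)) (fun n => Eventually.of_forall fun η => ?_)
      (Eventually.of_forall fun η => ?_)
    · exact Measurable.aestronglyMeasurable (by fun_prop)
    · rw [norm_mul, Real.norm_eq_abs, Real.norm_eq_abs, abs_of_pos (Real.exp_pos _),
        abs_of_pos (Real.exp_pos _)]
      exact mul_le_of_le_one_left (Real.exp_pos _).le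
        (Real.exp_le_one_iff.2 (neg_nonpos.2 (by positivity)))
    · have hc : Continuous (fun ε : ℝ => Real.exp (-(t * ‖√ε • η‖ ^ α)) *
          Real.exp (-(1 / 4 * ‖η‖ ^ 2))) := by
        have : Continuous (fun ε : ℝ => ‖√ε • η‖ ^ α) :=
          Continuous.rpow_const (by fun_prop) fun _ => Or.inr hα.le
        fun_prop
      have := (hc.tendsto 0).comp hδlim
      simpa [Real.zero_rpow hα.ne', Function.comp_def] using this
  have h4 : ∫ η : Space d, Real.exp (-(1 / 4 * ‖η‖ ^ 2)) =
      (Real.pi / (1 / 4)) ^ ((d : ℝ) / 2) := by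
    have := integral_cos_mul_gaussian (d := d) (b := 1 / 4) (by norm_num) 0
    simpa using this
  have h5 : ((2 * Real.pi) ^ d)⁻¹ * (Real.pi ^ ((d : ℝ) / 2) *
      (Real.pi / (1 / 4)) ^ ((d : ℝ) / 2)) = 1 := by
    rw [← Real.mul_rpow Real.pi_pos.le (by positivity)]
    have : Real.pi * (Real.pi / (1 / 4)) = (2 * Real.pi) ^ 2 := by ring
    rw [this, ← Real.rpow_natCast (2 * Real.pi) 2, ← Real.rpow_mul (by positivity)]
    have : ((2 : ℕ) : ℝ) * ((d : ℝ) / 2) = d := by push_cast; ring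
    rw [this, Real.rpow_natCast]
    exact inv_mul_cancel₀ (by positivity)
  have h6 := (ENNReal.continuous_ofReal.tendsto _).comp
    ((h3.const_mul (Real.pi ^ ((d : ℝ) / 2))).const_mul ((2 * Real.pi) ^ d)⁻¹)
  rw [h4, h5, ENNReal.ofReal_one] at h6
  refine tendsto_nhds_unique h1 (h6.congr fun n => ?_)
  rw [h2]; rfl

theorem lintegral_enorm_stableDensity_sub (hd : 0 < d) (hα : 0 < α) (hα2 : α ≤ 2) {t : ℝ}
    (ht : 0 < t) (x : Space d) : ∫⁻ y : Space d, ‖stableDensity α t (x - y)‖ₑ = 1 := by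
  rw [lintegral_sub_left_eq_self (fun y => ‖stableDensity α t y‖ₑ),
    ← lintegral_stableDensity hd hα hα2 ht]
  refine lintegral_congr fun y => ?_
  exact Real.enorm_of_nonneg (stableDensity_nonneg hd hα hα2 ht y)

/-! ### The constant in dimension one -/

theorem lintegral_min_one_norm_rpow (hα : 0 < α) :
    ∫⁻ x : Space 1, ENNReal.ofReal (if ‖x‖ ≤ 1 then 1 else ‖x‖ ^ (-(1 + α))) =
      ENNReal.ofReal (2 * ((1 + α) / α)) := by
  set m : ℝ → ℝ := fun r => if r ≤ 1 then 1 else r ^ (-(1 + α)) with hm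
  have hsplit : Ioi (0 : ℝ) = Ioc 0 1 ∪ Ioi 1 := (Ioc_union_Ioi_eq_Ioi zero_le_one).symm
  have hi1 : IntegrableOn m (Ioc 0 1) :=
    (integrableOn_const (C := (1 : ℝ)) (by simp)).congr_fun
      (fun y hy => by simp [hm, hy.2]) measurableSet_Ioc
  have hi2 : IntegrableOn m (Ioi 1) :=
    (integrableOn_Ioi_rpow_of_lt (a := -(1 + α)) (by linarith) one_pos).congr_fun
      (fun y hy => by simp [hm, not_le.2 (show (1 : ℝ) < y from hy)]) measurableSet_Ioi
  have hI : ∫ y in Ioi (0 : ℝ), m y = (1 + α) / α := by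
    rw [hsplit, setIntegral_union (by
        rw [Set.disjoint_left]; exact fun y h1 h2 => not_lt.2 h1.2 h2) measurableSet_Ioi hi1 hi2]
    have e1 : ∫ y in Ioc (0 : ℝ) 1, m y = 1 := by
      rw [setIntegral_congr_fun (g := fun _ => (1 : ℝ)) measurableSet_Ioc
        (fun y hy => by simp [hm, hy.2])]
      simp
    have e2 : ∫ y in Ioi (1 : ℝ), m y = 1 / α := by
      rw [setIntegral_congr_fun (g := fun y => y ^ (-(1 + α))) measurableSet_Ioi
        (fun y hy => by simp [hm, not_le.2 (show (1 : ℝ) < y from hy)]),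
        integral_Ioi_rpow_of_lt (by linarith) one_pos, Real.one_rpow]
      have : -(1 + α) + 1 = -α := by ring
      rw [this, neg_div_neg_eq]
    rw [e1, e2]; field_simp; ring
  have hint : Integrable (fun x : Space 1 => m ‖x‖) := by
    refine (integrable_fun_norm_addHaar (volume : Measure (Space 1))).2 ?_
    rw [hsplit]
    refine (hi1.union hi2).congr_fun (fun y _ => ?_) (measurableSet_Ioc.union measurableSet_Ioi)
    simp
  have hvol : (volume : Measure (Space 1)).real (Metric.ball 0 1) = 2 := by
    rw [Measure.real, EuclideanSpace.volume_ball]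
    have : Real.Gamma (((1 : ℕ) : ℝ) / 2 + 1) = √Real.pi / 2 := by
      push_cast
      rw [Real.Gamma_add_one (by norm_num), Real.Gamma_one_half_eq]; ring
    have hp : 0 < √Real.pi := Real.sqrt_pos.2 Real.pi_pos
    simp only [Fintype.card_fin, this, ENNReal.ofReal_one, one_mul, pow_one]
    rw [ENNReal.toReal_ofReal (by positivity)]
    field_simp
  have hI2 : ∫ x : Space 1, m ‖x‖ = 2 * ((1 + α) / α) := by
    rw [integral_fun_norm_addHaar, hvol]
    simp [hI]
  rw [← hI2, ofReal_integral_eq_lintegral_ofReal hint]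
  refine Eventually.of_forall fun x => ?_
  simp only [hm]
  split_ifs
  · exact zero_le_one
  · exact Real.rpow_nonneg (norm_nonneg _) _

/-- Integrate `p(1, x) ≤ C(1,α) (1 ∧ |x|^{-1-α})` over the line, where the left side has mass one.
-/
theorem one_le_heatKernelConst_mul (hα : 0 < α) (hα2 : α ≤ 2) :
    1 ≤ heatKernelConst 1 α * ENNReal.ofReal (2 * ((1 + α) / α)) := by
  have hC : ∀ x : Space 1, ENNReal.ofReal (max ((1 : ℝ) ^ (((1 : ℕ) : ℝ) / α) *
      stableDensity α 1 x) (‖x‖ ^ (((1 : ℕ) : ℝ) + α) / 1 * stableDensity α 1 x)) ≤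
      heatKernelConst 1 α := fun x => by
    unfold heatKernelConst
    exact le_iSup_of_le (1 : ℝ) (le_iSup_of_le one_pos (le_iSup_of_le x le_rfl))
  have hm : Measurable (fun x : Space 1 =>
      ENNReal.ofReal (if ‖x‖ ≤ 1 then 1 else ‖x‖ ^ (-(1 + α)))) := by
    refine Measurable.ennreal_ofReal (Measurable.ite ?_ measurable_const (by fun_prop))
    exact measurableSet_le (by fun_prop) measurable_const
  rw [← lintegral_min_one_norm_rpow hα, ← lintegral_const_mul _ hm,
    ← lintegral_stableDensity one_pos hα hα2 one_pos]
  refine lintegral_mono fun x => ?_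
  have h0 := stableDensity_nonneg one_pos hα hα2 one_pos x
  by_cases hx : ‖x‖ ≤ 1
  · simp only [hx, if_true, ENNReal.ofReal_one, mul_one]
    refine le_trans (ENNReal.ofReal_le_ofReal ?_) (hC x)
    rw [Real.one_rpow, one_mul]
    exact le_max_left _ _
  · simp only [hx, if_false]
    have hx0 : 0 < ‖x‖ := zero_lt_one.trans (not_le.1 hx)
    refine le_trans ?_ (mul_le_mul_left (hC x) _)
    rw [← ENNReal.ofReal_mul' (by positivity)]
    apply ENNReal.ofReal_le_ofReal
    have hp : (0 : ℝ) < ‖x‖ ^ (-(1 + α)) := by positivity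
    calc stableDensity α 1 x =
        ‖x‖ ^ (((1 : ℕ) : ℝ) + α) / 1 * stableDensity α 1 x * ‖x‖ ^ (-(1 + α)) := by
          have : ‖x‖ ^ (((1 : ℕ) : ℝ) + α) * ‖x‖ ^ (-(1 + α)) = 1 := by
            rw [← Real.rpow_add hx0]; simp
          rw [div_one, mul_right_comm, this, one_mul]
      _ ≤ _ := by gcongr; exact le_max_right _ _

/-- In dimension one `γ = 0`, so the Gamma factor is `1/β` and the remaining factors have product at
least one; hence `1/β ≤ C_{1,α,β} < 1/L`. -/
theorem lt_of_solutionConst_lt (hα : 0 < α) (hα2 : α ≤ 2) {β L : ℝ} (hβ : 0 < β) (hL : 0 < L)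
    (hC : solutionConst 1 α β < ENNReal.ofReal (1 / L)) : L < β := by
  have h1 : solutionConst 1 α β =
      heatKernelConst 1 α * ENNReal.ofReal (2 * ((1 + α) / α)) * ENNReal.ofReal (1 / β) := by
    have h2 : ENNReal.ofReal 2 = 2 := by simp
    unfold solutionConst
    simp only [Nat.cast_one, sub_self, zero_div, zero_add, Real.Gamma_one, Real.rpow_one,
      add_sub_cancel_left]
    rw [ENNReal.ofReal_mul (by positivity), ENNReal.ofReal_mul (by positivity), h2]
    ring
  have h2 : ENNReal.ofReal (1 / β) ≤ solutionConst 1 α β := by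
    rw [h1]
    exact le_mul_of_one_le_left (zero_le) (one_le_heatKernelConst_mul hα hα2)
  have h3 := (ENNReal.ofReal_lt_ofReal_iff (by positivity)).1 (h2.trans_lt hC)
  exact (one_div_lt_one_div hβ hL).1 h3

end Density

/-! ### Poisson random measures: means, regularity, independence -/

section Poisson

variable {Ω X : Type*} [MeasurableSpace Ω] [MeasurableSpace X] {N : Ω → Measure X}
  {μ : Measure X} {P : Measure Ω}

theorem IsPoissonRandomMeasure.measurable_apply (hN : IsPoissonRandomMeasure N μ P) {A : Set X}
    (hA : MeasurableSet A) : Measurable (fun ω => N ω A) :=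
  (Measure.measurable_coe hA).comp hN.measurable

theorem tsum_ofReal_poisson {r : ℝ} (hr : 0 ≤ r) :
    ∑' n : ℕ, ENNReal.ofReal (r ^ n * Real.exp (-r) / (n.factorial : ℝ)) = 1 := by
  have h : HasSum (fun n : ℕ => r ^ n * Real.exp (-r) / (n.factorial : ℝ)) 1 := by
    have h1 := (NormedSpace.expSeries_div_hasSum_exp r).mul_right (Real.exp (-r))
    rw [← Real.exp_eq_exp_ℝ, ← Real.exp_add, add_neg_cancel, Real.exp_zero] at h1
    refine h1.congr_fun ?_
    intro n; ring
  rw [← ENNReal.ofReal_tsum_of_nonneg (fun n => by positivity) h.summable, h.tsum_eq,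
    ENNReal.ofReal_one]

/-- The mean is computed from the Poisson weights, shifting the index by one in `n · r^n / n!`. -/
theorem IsPoissonRandomMeasure.lintegral_apply [IsProbabilityMeasure P]
    (hN : IsPoissonRandomMeasure N μ P) {A : Set X} (hA : MeasurableSet A) (hμ : μ A ≠ ∞) :
    ∫⁻ ω, N ω A ∂P = μ A := by
  have hm := hN.measurable_apply hA
  set r := (μ A).toReal with hr
  have hr0 : 0 ≤ r := ENNReal.toReal_nonneg
  have hms : ∀ n : ℕ, MeasurableSet {ω | N ω A = n} := fun n => hm (measurableSet_singleton _)
  have hdisj : Pairwise (Function.onFun Disjoint fun n : ℕ => {ω | N ω A = n}) := by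
    intro i j hij
    refine Set.disjoint_left.2 fun ω h1 h2 => hij ?_
    have : ((i : ℝ≥0∞)) = j := by rw [← h1.out, ← h2.out]
    exact_mod_cast this
  -- The Poisson weights sum to one, which excludes the value `∞` almost surely.
  have hfull : ∀ᵐ ω ∂P, ω ∈ ⋃ n : ℕ, {ω | N ω A = n} := by
    have : P (⋃ n : ℕ, {ω | N ω A = n}) = 1 := by
      rw [measure_iUnion hdisj hms]
      simp only [hN.poisson A hA hμ]
      exact tsum_ofReal_poisson hr0
    exact (prob_compl_eq_zero_iff (MeasurableSet.iUnion hms)).2 this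
  have e1 : ∫⁻ ω, N ω A ∂P =
      ∫⁻ ω, ∑' n : ℕ, {ω | N ω A = n}.indicator (fun _ => (n : ℝ≥0∞)) ω ∂P := by
    refine lintegral_congr_ae ?_
    filter_upwards [hfull] with ω hω
    obtain ⟨k, hk⟩ := mem_iUnion.1 hω
    have hk : N ω A = k := hk
    rw [tsum_eq_single k]
    · rw [indicator_of_mem (by exact hk), hk]
    · intro j hj
      refine indicator_of_notMem (fun h => hj ?_) _
      have h : N ω A = j := h
      rw [hk] at h
      exact_mod_cast h.symm
  rw [e1, lintegral_tsum fun n => (measurable_const.indicator (hms n)).aemeasurable]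
  have e2 : ∀ n : ℕ, ∫⁻ ω, {ω | N ω A = n}.indicator (fun _ => (n : ℝ≥0∞)) ω ∂P =
      n * ENNReal.ofReal (r ^ n * Real.exp (-r) / (n.factorial : ℝ)) := by
    intro n
    rw [lintegral_indicator_const (hms n), hN.poisson A hA hμ]
  simp only [e2]
  rw [tsum_eq_zero_add' ENNReal.summable]
  have e3 : ∀ n : ℕ, ((n + 1 : ℕ) : ℝ≥0∞) *
      ENNReal.ofReal (r ^ (n + 1) * Real.exp (-r) / ((n + 1).factorial : ℝ)) =
      ENNReal.ofReal r * ENNReal.ofReal (r ^ n * Real.exp (-r) / (n.factorial : ℝ)) := by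
    intro n
    rw [← ENNReal.ofReal_natCast, ← ENNReal.ofReal_mul (by positivity), ← ENNReal.ofReal_mul hr0]
    congr 1
    rw [Nat.factorial_succ]
    push_cast
    field_simp
    ring
  simp only [e3]
  rw [ENNReal.tsum_mul_left, tsum_ofReal_poisson hr0, hr, ENNReal.ofReal_toReal hμ]
  simp

theorem IsPoissonRandomMeasure.ae_eq_zero [IsProbabilityMeasure P]
    (hN : IsPoissonRandomMeasure N μ P) {A : Set X} (hA : MeasurableSet A) (hμ : μ A = 0) :
    ∀ᵐ ω ∂P, N ω A = 0 := by
  have h := hN.lintegral_apply hA (by simp [hμ])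
  rw [hμ, lintegral_eq_zero_iff (hN.measurable_apply hA)] at h
  exact h

/-- The countable measurable partition into sets of finite measure attached to a σ-finite measure. -/
def cells (μ : Measure X) [SigmaFinite μ] : ℕ → Set X := disjointed (spanningSets μ)

theorem measurableSet_cells (μ : Measure X) [SigmaFinite μ] (n : ℕ) : MeasurableSet (cells μ n) :=
  MeasurableSet.disjointed (fun n => measurableSet_spanningSets μ n) n

theorem disjoint_cells (μ : Measure X) [SigmaFinite μ] :
    Pairwise (Function.onFun Disjoint (cells μ)) := disjoint_disjointed _

theorem iUnion_cells (μ : Measure X) [SigmaFinite μ] : ⋃ n, cells μ n = univ := by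
  rw [cells, iUnion_disjointed, iUnion_spanningSets]

theorem measure_cells_lt_top (μ : Measure X) [SigmaFinite μ] (n : ℕ) : μ (cells μ n) < ∞ :=
  (measure_mono (disjointed_subset _ n)).trans_lt (measure_spanningSets_lt_top μ n)

theorem IsPoissonRandomMeasure.ae_cells_lt_top [IsProbabilityMeasure P] [SigmaFinite μ]
    (hN : IsPoissonRandomMeasure N μ P) : ∀ᵐ ω ∂P, ∀ n, N ω (cells μ n) < ∞ := by
  rw [ae_all_iff]
  intro n
  refine ae_lt_top (hN.measurable_apply (measurableSet_cells μ n)) ?_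
  rw [hN.lintegral_apply (measurableSet_cells μ n) (measure_cells_lt_top μ n).ne]
  exact (measure_cells_lt_top μ n).ne

/-! ### Regularization of a measurable family of measures to an s-finite kernel -/

theorem measurable_restrict_const {T : Type*} [MeasurableSpace T] {κ : T → Measure X}
    (hκ : Measurable κ) {S : Set X} (hS : MeasurableSet S) :
    Measurable fun t => (κ t).restrict S := by
  refine Measure.measurable_of_measurable_coe _ fun B hB => ?_
  simp only [Measure.restrict_apply hB]
  exact (Measure.measurable_coe (hB.inter hS)).comp hκ

open Classical in
/-- The kernel which agrees with `κ` where `κ` is finite on all cells, and vanishes elsewhere. -/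
def regularKernel {T : Type*} [MeasurableSpace T] (κ : T → Measure X) (hκ : Measurable κ)
    (S : ℕ → Set X) (hS : ∀ n, MeasurableSet (S n)) : Kernel T X where
  toFun t := if ∀ n, κ t (S n) < ∞ then κ t else 0
  measurable' := by
    refine Measurable.ite ?_ hκ measurable_const
    have : {t | ∀ n, κ t (S n) < ∞} = ⋂ n, {t | κ t (S n) < ∞} := by ext; simp
    rw [this]
    exact MeasurableSet.iInter fun n =>
      measurableSet_lt ((Measure.measurable_coe (hS n)).comp hκ) measurable_const

theorem regularKernel_apply {T : Type*} [MeasurableSpace T] (κ : T → Measure X)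
    (hκ : Measurable κ) (S : ℕ → Set X) (hS : ∀ n, MeasurableSet (S n)) {t : T}
    (ht : ∀ n, κ t (S n) < ∞) : regularKernel κ hκ S hS t = κ t := by
  exact if_pos ht

/-- A kernel finite on each cell need not be uniformly bounded there. Splitting the parameter space
according to the integer part of `κ t (S n)` yields countably many finite kernels that sum to it. -/
theorem isSFiniteKernel_regularKernel {T : Type*} [MeasurableSpace T] (κ : T → Measure X)
    (hκ : Measurable κ) (S : ℕ → Set X) (hS : ∀ n, MeasurableSet (S n))
    (hdisj : Pairwise (Function.onFun Disjoint S)) (hU : ⋃ n, S n = univ) :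
    IsSFiniteKernel (regularKernel κ hκ S hS) := by
  classical
  have hmS : ∀ n, Measurable fun t => κ t (S n) :=
    fun n => (Measure.measurable_coe (hS n)).comp hκ
  set A : ℕ × ℕ → Set T := fun p =>
    {t | (∀ n, κ t (S n) < ∞) ∧ (p.2 : ℝ≥0∞) ≤ κ t (S p.1) ∧ κ t (S p.1) < p.2 + 1} with hA
  have hAm : ∀ p, MeasurableSet (A p) := by
    intro p
    have : A p = (⋂ n, {t | κ t (S n) < ∞}) ∩
        ({t | (p.2 : ℝ≥0∞) ≤ κ t (S p.1)} ∩ {t | κ t (S p.1) < p.2 + 1}) := by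
      ext; simp [hA]
    rw [this]
    exact (MeasurableSet.iInter fun n => measurableSet_lt (hmS n) measurable_const).inter
      ((measurableSet_le measurable_const (hmS _)).inter
        (measurableSet_lt (hmS _) measurable_const))
  let η : ℕ × ℕ → Kernel T X := fun p =>
    { toFun := fun t => if t ∈ A p then (κ t).restrict (S p.1) else 0
      measurable' := Measurable.ite (hAm p)
        (measurable_restrict_const hκ (hS p.1)) measurable_const }
  have hη : ∀ p, IsFiniteKernel (η p) := by
    intro p
    refine ⟨⟨p.2 + 1, by simp [ENNReal.add_lt_top], fun t => ?_⟩⟩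
    change (if t ∈ A p then (κ t).restrict (S p.1) else 0) univ ≤ _
    split_ifs with h
    · rw [Measure.restrict_apply_univ]; exact h.2.2.le
    · simp
  have : regularKernel κ hκ S hS = Kernel.sum η := by
    ext t B hB
    rw [Kernel.sum_apply, Measure.sum_apply _ hB]
    change (if ∀ n, κ t (S n) < ∞ then κ t else 0) B =
      ∑' p : ℕ × ℕ, (if t ∈ A p then (κ t).restrict (S p.1) else 0) B
    split_ifs with h
    · rw [ENNReal.tsum_prod']
      have e : ∀ n, ∑' m, (if t ∈ A (n, m) then (κ t).restrict (S n) else 0) B =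
          κ t (B ∩ S n) := by
        intro n
        set y := (κ t (S n)).toNNReal with hy
        have hy' : (y : ℝ≥0∞) = κ t (S n) := ENNReal.coe_toNNReal (h n).ne
        have hmem : ∀ m : ℕ, t ∈ A (n, m) ↔ ⌊y⌋₊ = m := by
          intro m
          simp only [hA, mem_ofPred_eq, h, implies_true, true_and, ← hy']
          rw [Nat.floor_eq_iff (zero_le)]
          norm_cast
        rw [tsum_eq_single ⌊y⌋₊]
        · rw [if_pos ((hmem _).2 rfl), Measure.restrict_apply hB]
        · intro m hm
          rw [if_neg (fun hh => hm ((hmem m).1 hh).symm)]; simp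
      simp only [e]
      rw [← measure_iUnion (fun i j hij => (hdisj hij).mono inter_subset_right inter_subset_right)
        (fun n => hB.inter (hS n)), ← inter_iUnion, hU, inter_univ]
    · have : ∀ p, t ∉ A p := fun p hp => h hp.1
      simp [this]
  rw [this]
  infer_instance

/-! ### Independence -/

theorem IsPoissonRandomMeasure.iIndepFun_of_fintype (hN : IsPoissonRandomMeasure N μ P)
    {ι : Type*} [Fintype ι] (A : ι → Set X) (hA : ∀ i, MeasurableSet (A i))
    (hd : Pairwise (Function.onFun Disjoint A)) : iIndepFun (fun i ω => N ω (A i)) P := by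
  set e := Fintype.equivFin ι
  have h := hN.indep _ (fun k => A (e.symm k)) (fun k => hA _)
    (fun i j hij => hd (fun h => hij (e.symm.injective h)))
  have h2 := h.precomp (g := e) e.injective
  simpa using h2

/-- The sets `C i` may overlap, whereas the definition gives independence only over disjoint sets.
Each `N (C i)` is a sum over atoms of the finite family. -/
theorem IsPoissonRandomMeasure.indepFun_of_disjoint [IsProbabilityMeasure P]
    (hN : IsPoissonRandomMeasure N μ P) {ι : Type*} [Fintype ι] (C : ι → Set X)
    (hC : ∀ i, MeasurableSet (C i)) {B : Set X} (hB : MeasurableSet B)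
    (hd : ∀ i, Disjoint (C i) B) :
    IndepFun (fun ω i => N ω (C i)) (fun ω => N ω B) P := by
  classical
  -- The index `none` stands for `B`; `some T` is the atom of points outside `B` that lie in `C i`
  -- exactly when `i ∈ T`.
  let a : Option (Finset ι) → Set X := fun o => o.elim B fun T =>
    Bᶜ ∩ ⋂ i, if i ∈ T then C i else (C i)ᶜ
  have ham : ∀ o, MeasurableSet (a o) := by
    rintro (_ | T)
    · exact hB
    · refine hB.compl.inter (MeasurableSet.iInter fun i => ?_)
      split_ifs
      exacts [hC i, (hC i).compl]
  have hmem : ∀ (T : Finset ι) (z : X), z ∈ a (some T) ↔ z ∉ B ∧ ∀ i, i ∈ T ↔ z ∈ C i := by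
    intro T z
    simp only [a, Option.elim_some, mem_inter_iff, mem_compl_iff, mem_iInter]
    refine and_congr_right fun _ => forall_congr' fun i => ?_
    split_ifs with h <;> simp [h]
  have had : Pairwise (Function.onFun Disjoint a) := by
    rintro (_ | T) (_ | T') hne
    · exact absurd rfl hne
    · exact Set.disjoint_left.2 fun z h1 h2 => ((hmem _ _).1 h2).1 h1
    · exact Set.disjoint_left.2 fun z h1 h2 => ((hmem _ _).1 h1).1 h2
    · refine Set.disjoint_left.2 fun z h1 h2 => hne ?_
      congr 1
      ext i
      rw [((hmem _ _).1 h1).2 i, ((hmem _ _).1 h2).2 i]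
  have hind := hN.iIndepFun_of_fintype a ham had
  set S1 : Finset (Option (Finset ι)) := Finset.univ.map Function.Embedding.some with hS1
  have h2 := hind.indepFun_finset S1 {none} (by simp [hS1]) fun o => hN.measurable_apply (ham o)
  have hS1m : ∀ T : Finset ι, some T ∈ S1 := fun T => by simp [hS1]
  let φ : (S1 → ℝ≥0∞) → ι → ℝ≥0∞ := fun v i =>
    ∑ T ∈ Finset.univ.filter (fun T : Finset ι => i ∈ T), v ⟨some T, hS1m T⟩
  let ψ : (({none} : Finset (Option (Finset ι))) → ℝ≥0∞) → ℝ≥0∞ := fun v => v ⟨none, by simp⟩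
  have hφ : Measurable φ := measurable_pi_lambda _ fun i => by fun_prop
  have hψ : Measurable ψ := by fun_prop
  have h3 := h2.comp hφ hψ
  have e1 : (φ ∘ fun ω (i : S1) => N ω (a i)) = fun ω i => N ω (C i) := by
    ext ω i
    simp only [Function.comp_apply, φ]
    rw [← measure_biUnion_finset (f := fun T => a (some T))
      (fun T _ T' _ hne => had (fun h => hne (Option.some_injective _ h))) (fun T _ => ham _)]
    congr 1
    ext z
    simp only [mem_iUnion, Finset.mem_filter, Finset.mem_univ, true_and, exists_prop, hmem]
    constructor
    · rintro ⟨T, hT, -, h⟩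
      exact (h i).1 hT
    · intro hz
      refine ⟨Finset.univ.filter fun j => z ∈ C j, by simpa using hz,
        Set.disjoint_left.1 (hd i) hz, by simp⟩
  rw [e1] at h3
  exact h3

end Poisson

/-! ### Independence of past and future noise, and Campbell's formula -/

section Campbell

variable {d : ℕ} {Ω : Type*} [mΩ : MeasurableSpace Ω]
  {N : Ω → Measure (ℝ≥0 × Space d × Space d)} {μ : Measure (ℝ≥0 × Space d × Space d)}
  {P : Measure Ω}

theorem measurable_noiseFiltration_apply (hN : Measurable N) (t : ℝ≥0)
    {C : Set (ℝ≥0 × Space d × Space d)} (hC : MeasurableSet C) (hCt : C ⊆ Iic t ×ˢ univ) :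
    Measurable[noiseFiltration N hN P t] (fun ω => N ω C) := by
  have : MeasurableSpace.comap (fun ω => N ω C) inferInstance ≤ noiseFiltration N hN P t :=
    le_sup_of_le_left (le_iSup_of_le C (le_iSup_of_le hC (le_iSup_of_le hCt le_rfl)))
  exact Measurable.mono (comap_measurable _) this le_rfl

/-- The σ-algebra of the noise up to time `s`, not augmented by the null sets. -/
abbrev pastNoise (N : Ω → Measure (ℝ≥0 × Space d × Space d)) (s : ℝ≥0) : MeasurableSpace Ω :=
  ⨆ C : {C : Set (ℝ≥0 × Space d × Space d) // MeasurableSet C ∧ C ⊆ Iic s ×ˢ univ},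
    MeasurableSpace.comap (fun ω => N ω C.1) inferInstance

theorem pastNoise_le (hN : Measurable N) (s : ℝ≥0) : pastNoise N s ≤ mΩ :=
  iSup_le fun C => ((Measure.measurable_coe C.2.1).comp hN).comap_le

/-- The sets almost surely equal to an event of the past noise form a σ-algebra, which contains the
generators and the null sets. -/
theorem exists_pastNoise_ae_eq (hN : Measurable N) (s : ℝ≥0) {A : Set Ω}
    (hA : MeasurableSet[noiseFiltration N hN P s] A) :
    ∃ A', MeasurableSet[pastNoise N s] A' ∧ A =ᵐ[P] A' := by
  have hle : noiseFiltration N hN P s ≤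
      @eventuallyMeasurableSpace _ (pastNoise N s) (ae P) _ := by
    refine sup_le (iSup_le fun C => iSup_le fun hC => iSup_le fun hCs => ?_)
      (MeasurableSpace.generateFrom_le fun A hA => ?_)
    · exact le_trans (le_iSup (fun C : {C : Set (ℝ≥0 × Space d × Space d) //
        MeasurableSet C ∧ C ⊆ Iic s ×ˢ univ} =>
          MeasurableSpace.comap (fun ω => N ω C.1) inferInstance) ⟨C, hC, hCs⟩)
        (@le_eventuallyMeasurableSpace _ (pastNoise N s) (ae P) _)
    · exact ⟨∅, @MeasurableSet.empty _ (pastNoise N s), ae_eq_empty.2 hA.2⟩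
  obtain ⟨A', h1, h2⟩ := hle A hA
  exact ⟨A', h1, h2⟩

/-- The noise up to time `s` is independent of the noise after time `s`. -/
theorem IsPoissonRandomMeasure.indep_pastNoise [IsProbabilityMeasure P]
    (hN : IsPoissonRandomMeasure N μ P) (s : ℝ≥0) {B : Set (ℝ≥0 × Space d × Space d)}
    (hB : MeasurableSet B) (hBs : B ⊆ Ioi s ×ˢ univ) :
    Indep (pastNoise N s) (MeasurableSpace.comap (fun ω => N ω B) inferInstance) P := by
  set f : {C : Set (ℝ≥0 × Space d × Space d) // MeasurableSet C ∧ C ⊆ Iic s ×ˢ univ} →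
    MeasurableSpace Ω := fun C => MeasurableSpace.comap (fun ω => N ω C.1) inferInstance with hf
  have hgen := generateFrom_piiUnionInter_measurableSet f univ
  -- Finite intersections of events, each depending on one `N C`, form a π-system generating the
  -- past; on it the claim concerns finitely many sets `C` disjoint from `B`.
  refine @IndepSets.indep _ _ _ mΩ P _
    (piiUnionInter (fun i => {s | MeasurableSet[f i] s}) univ)
    {s | MeasurableSet[(MeasurableSpace.comap (fun ω => N ω B) inferInstance)] s} (pastNoise_le hN.measurable s) (hN.measurable_apply hB).comap_le
    (isPiSystem_piiUnionInter _ (fun i => @MeasurableSpace.isPiSystem_measurableSet _ (f i)) _)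
    (@MeasurableSpace.isPiSystem_measurableSet _ (MeasurableSpace.comap (fun ω => N ω B) inferInstance)) ?_
    (@MeasurableSpace.generateFrom_measurableSet _ (MeasurableSpace.comap (fun ω => N ω B) inferInstance)).symm ?_
  · rw [hgen]; simp [pastNoise, hf]
  rw [IndepSets_iff]
  rintro t1 t2 ⟨T, -, g, hg, rfl⟩ ⟨E, hE, rfl⟩
  have hind := hN.indepFun_of_disjoint (ι := T) (fun i => i.1.1) (fun i => i.1.2.1) hB
    (fun i => Set.disjoint_left.2 fun z h1 h2 =>
      not_lt.2 (show z.1 ≤ s from (i.1.2.2 h1).1) (hBs h2).1)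
  choose E' hE' hE'g using fun i : T => hg i.1 i.2
  have e : ⋂ i ∈ T, g i =
      (fun ω (i : T) => N ω i.1.1) ⁻¹' (⋂ i : T, (fun v => v i) ⁻¹' (E' i)) := by
    ext ω
    simp only [mem_iInter, mem_preimage, Subtype.forall]
    refine forall_congr' fun C => forall_congr' fun hC => forall_congr' fun hi => ?_
    rw [← hE'g ⟨⟨C, hC⟩, hi⟩]
    rfl
  rw [e]
  exact hind.measure_inter_preimage_eq_mul _ _
    (MeasurableSet.iInter fun i => measurable_pi_apply i (hE' i)) hE

/-- This is Campbell's formula for elementary predictable integrands: after replacing `A` by an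
unaugmented past event, independence factorizes the mean. -/
theorem IsPoissonRandomMeasure.lintegral_indicator [IsProbabilityMeasure P]
    (hN : IsPoissonRandomMeasure N μ P) (s : ℝ≥0) {B : Set (ℝ≥0 × Space d × Space d)}
    (hB : MeasurableSet B) (hBs : B ⊆ Ioi s ×ˢ univ) (hμ : μ B ≠ ∞) {A : Set Ω}
    (hA : MeasurableSet[noiseFiltration N hN.measurable P s] A) :
    ∫⁻ ω, A.indicator (fun ω => N ω B) ω ∂P = P A * μ B := by
  obtain ⟨A', hA', hAA'⟩ := exists_pastNoise_ae_eq hN.measurable s hA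
  have hle := pastNoise_le hN.measurable s
  have h1 : ∫⁻ ω, A.indicator (fun ω => N ω B) ω ∂P =
      ∫⁻ ω, A'.indicator (fun _ => 1) ω * N ω B ∂P := by
    refine lintegral_congr_ae ?_
    refine (indicator_ae_eq_of_ae_eq_set hAA').trans (Eventually.of_forall fun ω => ?_)
    by_cases h : ω ∈ A' <;> simp [h]
  have hA'm : Measurable[pastNoise N s] (A'.indicator (fun _ => (1 : ℝ≥0∞))) :=
    Measurable.indicator measurable_const hA'
  have h2 := @lintegral_mul_eq_lintegral_mul_lintegral_of_independent_measurableSpace _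
    (A'.indicator (fun _ => 1)) (fun ω => N ω B) _ _ mΩ P hle
    (hN.measurable_apply hB).comap_le (hN.indep_pastNoise s hB hBs) hA'm
    (comap_measurable _)
  rw [h1, h2, hN.lintegral_apply hB hμ, lintegral_indicator_const (hle _ hA'), one_mul,
    measure_congr hAA']

theorem predictable_le (ℱ : Filtration ℝ≥0 (inferInstance : MeasurableSpace Ω)) :
    ℱ.predictable ≤ (inferInstance : MeasurableSpace (ℝ≥0 × Ω)) :=
  measurableSpace_le_predictable_of_measurableSet
    (fun A hA => (measurableSet_singleton _).prod (ℱ.le _ A hA))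
    (fun _ A hA => measurableSet_Ioi.prod (ℱ.le _ A hA))

/-- The relabelling of `(ω, (s, z))` as `((s, ω), z)`. -/
def shuffle {Ω Z : Type*} (q : Ω × ℝ≥0 × Z) : (ℝ≥0 × Ω) × Z := ((q.2.1, q.1), q.2.2)

theorem measurable_shuffle {Z : Type*} [MeasurableSpace Z]
    (ℱ : Filtration ℝ≥0 (inferInstance : MeasurableSpace Ω)) :
    @Measurable _ _ _ (ℱ.predictable.prod (inferInstance : MeasurableSpace Z))
      (shuffle : Ω × ℝ≥0 × Z → (ℝ≥0 × Ω) × Z) := by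
  have h : Measurable (shuffle : Ω × ℝ≥0 × Z → (ℝ≥0 × Ω) × Z) := by
    unfold shuffle; fun_prop
  exact h.mono le_rfl (sup_le_sup_right (MeasurableSpace.comap_mono (predictable_le ℱ)) _)

/-- The generating rectangles of the predictable σ-algebra. -/
def predictableRectangles (ℱ : Filtration ℝ≥0 (inferInstance : MeasurableSpace Ω)) :
    Set (Set (ℝ≥0 × Ω)) :=
  {s | ∃ A, MeasurableSet[ℱ ⊥] A ∧ s = {⊥} ×ˢ A} ∪
    {s | ∃ i A, MeasurableSet[ℱ i] A ∧ s = Set.Ioi i ×ˢ A}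

theorem isPiSystem_predictableRectangles
    (ℱ : Filtration ℝ≥0 (inferInstance : MeasurableSpace Ω)) :
    IsPiSystem (predictableRectangles ℱ) := by
  rintro _ (⟨A, hA, rfl⟩ | ⟨i, A, hA, rfl⟩) _ (⟨A', hA', rfl⟩ | ⟨j, A', hA', rfl⟩) hne
  · exact Or.inl ⟨A ∩ A', MeasurableSet.inter hA hA', by rw [prod_inter_prod, inter_self]⟩
  · obtain ⟨⟨s, ω⟩, ⟨h1, -⟩, h2, -⟩ := hne
    simp only [mem_singleton_iff] at h1
    subst h1
    exact absurd (show _ < (⊥ : ℝ≥0) from h2) not_lt_bot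
  · obtain ⟨⟨s, ω⟩, ⟨h2, -⟩, h1, -⟩ := hne
    simp only [mem_singleton_iff] at h1
    subst h1
    exact absurd (show _ < (⊥ : ℝ≥0) from h2) not_lt_bot
  · exact Or.inr ⟨i ⊔ j, A ∩ A', MeasurableSet.inter (ℱ.mono le_sup_left _ hA)
      (ℱ.mono le_sup_right _ hA'), by rw [prod_inter_prod, Ioi_inter_Ioi]⟩

theorem isCountablySpanning_predictableRectangles
    (ℱ : Filtration ℝ≥0 (inferInstance : MeasurableSpace Ω)) :
    IsCountablySpanning (predictableRectangles ℱ) := by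
  refine ⟨fun n => if n = 0 then {⊥} ×ˢ univ else Ioi ⊥ ×ˢ univ, fun n => ?_, ?_⟩
  · dsimp only
    split_ifs
    · exact Or.inl ⟨univ, MeasurableSet.univ, rfl⟩
    · exact Or.inr ⟨⊥, univ, MeasurableSet.univ, rfl⟩
  · refine eq_univ_of_forall fun ⟨s, ω⟩ => mem_iUnion.2 ?_
    rcases eq_bot_or_bot_lt s with h | h
    · exact ⟨0, by simp [h]⟩
    · exact ⟨1, by simpa using h⟩

theorem isSFiniteKernel_regularKernel_noise [SigmaFinite μ] (hN : IsPoissonRandomMeasure N μ P) :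
    IsSFiniteKernel (regularKernel N hN.measurable (cells μ) (measurableSet_cells μ)) :=
  isSFiniteKernel_regularKernel _ _ _ _ (disjoint_cells μ) (iUnion_cells μ)

/-- Campbell's formula for predictable integrands. -/
theorem IsPoissonRandomMeasure.lintegral_lintegral_predictable [IsProbabilityMeasure P]
    [SigmaFinite μ] (hN : IsPoissonRandomMeasure N μ P) (hμ0 : μ ({0} ×ˢ univ) = 0)
    {f : (ℝ≥0 × Ω) × Space d × Space d → ℝ≥0∞}
    (hf : Measurable[(noiseFiltration N hN.measurable P).predictable.prod inferInstance] f) :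
    ∫⁻ ω, ∫⁻ z, f ((z.1, ω), z.2) ∂(N ω) ∂P = ∫⁻ z, ∫⁻ ω, f ((z.1, ω), z.2) ∂P ∂μ := by
  set ℱ := noiseFiltration N hN.measurable P with hℱ
  have hSF := isSFiniteKernel_regularKernel_noise hN
  -- The composition product needs a genuine s-finite kernel, which `N` is only almost surely.
  set κ := regularKernel N hN.measurable (cells μ) (measurableSet_cells μ) with hκ
  have hκN : ∀ᵐ ω ∂P, κ ω = N ω := by
    filter_upwards [hN.ae_cells_lt_top] with ω hω
    exact regularKernel_apply _ _ _ _ hω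
  have hφ := measurable_shuffle (Z := Space d × Space d) ℱ
  have hfφ : Measurable (f ∘ shuffle) := 
    @Measurable.comp _ _ _ _ (ℱ.predictable.prod inferInstance) _ _ _ hf hφ
  have hL : ∫⁻ ω, ∫⁻ z, f ((z.1, ω), z.2) ∂(N ω) ∂P =
      ∫⁻ q, (f ∘ shuffle) q ∂(P ⊗ₘ κ) := by
    rw [Measure.lintegral_compProd hfφ]
    refine lintegral_congr_ae ?_
    filter_upwards [hκN] with ω hω
    rw [hω]; rfl
  have hR : ∫⁻ z, ∫⁻ ω, f ((z.1, ω), z.2) ∂P ∂μ = ∫⁻ q, (f ∘ shuffle) q ∂(P.prod μ) := by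
    rw [lintegral_prod_symm _ hfφ.aemeasurable]; rfl
  rw [hL, hR]
  -- Localizing to one cell makes both measures finite, so that agreement on a π-system determines
  -- them.
  set S : ℕ → Set (Ω × ℝ≥0 × Space d × Space d) := fun n => univ ×ˢ cells μ n with hS
  have hSm : ∀ n, MeasurableSet (S n) := fun n => MeasurableSet.univ.prod (measurableSet_cells μ n)
  have hSd : Pairwise (Function.onFun Disjoint S) := fun i j hij =>
    Set.disjoint_left.2 fun q h1 h2 => Set.disjoint_left.1 (disjoint_cells μ hij) h1.2 h2.2
  have hSU : ⋃ n, S n = univ := by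
    rw [hS, ← prod_iUnion, iUnion_cells, univ_prod_univ]
  rw [← setLIntegral_univ, ← setLIntegral_univ (μ := P.prod μ), ← hSU, lintegral_iUnion hSm hSd,
    lintegral_iUnion hSm hSd]
  congr 1
  ext n
  -- Pushing both measures forward to the predictable σ-algebra reduces the formula for arbitrary
  -- `f` to equality of measures on rectangles.
  have key : @Measure.map _ _ _ (ℱ.predictable.prod inferInstance) shuffle
        ((P ⊗ₘ κ).restrict (S n)) =
      @Measure.map _ _ _ (ℱ.predictable.prod inferInstance) shuffle
        ((P.prod μ).restrict (S n)) := by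
    have hgen : ℱ.predictable.prod (inferInstance : MeasurableSpace (Space d × Space d)) =
        MeasurableSpace.generateFrom (image2 (· ×ˢ ·) (predictableRectangles ℱ)
          {s | MeasurableSet s}) := by
      have h := @generateFrom_prod_eq _ _ _ _ (isCountablySpanning_predictableRectangles ℱ)
        (isCountablySpanning_measurableSet (α := Space d × Space d))
      rw [MeasurableSpace.generateFrom_measurableSet] at h
      exact h
    have hval : ∀ D E, MeasurableSet[ℱ.predictable] D →
        MeasurableSet (E : Set (Space d × Space d)) →
        @Measure.map _ _ _ (ℱ.predictable.prod inferInstance) shuffle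
          ((P ⊗ₘ κ).restrict (S n)) (D ×ˢ E) =
            ∫⁻ ω, N ω {z | (z.1, ω) ∈ D ∧ z.2 ∈ E ∧ z ∈ cells μ n} ∂P ∧
        @Measure.map _ _ _ (ℱ.predictable.prod inferInstance) shuffle
          ((P.prod μ).restrict (S n)) (D ×ˢ E) =
            ∫⁻ ω, μ {z | (z.1, ω) ∈ D ∧ z.2 ∈ E ∧ z ∈ cells μ n} ∂P := by
      intro D E hD hE
      have hDE : @MeasurableSet _ (ℱ.predictable.prod inferInstance) (D ×ˢ E) :=
        @MeasurableSet.prod _ _ ℱ.predictable _ _ _ hD hE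
      have hpre : MeasurableSet (shuffle ⁻¹' (D ×ˢ E) ∩ S n :
          Set (Ω × ℝ≥0 × Space d × Space d)) := (hφ hDE).inter (hSm n)
      constructor
      · rw [Measure.map_apply hφ hDE, Measure.restrict_apply (hφ hDE),
          Measure.compProd_apply hpre]
        refine lintegral_congr_ae ?_
        filter_upwards [hκN] with ω hω
        rw [hω]
        congr 1
        ext z
        simp [shuffle, hS, and_assoc]
      · rw [Measure.map_apply hφ hDE, Measure.restrict_apply (hφ hDE), Measure.prod_apply hpre]
        refine lintegral_congr fun ω => ?_
        congr 1
        ext z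
        simp [shuffle, hS, and_assoc]
    have hfinS : ∀ B ⊆ cells μ n, μ B ≠ ∞ := fun B hB =>
      ((measure_mono hB).trans_lt (measure_cells_lt_top μ n)).ne
    have huniv : (univ : Set ((ℝ≥0 × Ω) × Space d × Space d)) = univ ×ˢ univ :=
      univ_prod_univ.symm
    have hu := hval univ univ MeasurableSet.univ MeasurableSet.univ
    have hset : ∀ ω : Ω, {z : ℝ≥0 × Space d × Space d | (z.1, ω) ∈ (univ : Set (ℝ≥0 × Ω)) ∧
        z.2 ∈ (univ : Set (Space d × Space d)) ∧ z ∈ cells μ n} = cells μ n := by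
      intro ω; ext; simp
    simp only [hset] at hu
    rw [hN.lintegral_apply (measurableSet_cells μ n) (measure_cells_lt_top μ n).ne,
      lintegral_const, measure_univ, mul_one, ← huniv] at hu
    refine @ext_of_generate_finite _ (ℱ.predictable.prod inferInstance) _ _ _ hgen
      ((isPiSystem_predictableRectangles ℱ).prod MeasurableSpace.isPiSystem_measurableSet)
      (@IsFiniteMeasure.mk _ (ℱ.predictable.prod inferInstance) _ ?_) ?_ ?_
    · rw [hu.1]; exact measure_cells_lt_top μ n
    · rintro _ ⟨D, hD, E, hE, rfl⟩
      have hE : MeasurableSet E := hE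
      have hDm : MeasurableSet[ℱ.predictable] D := MeasurableSpace.measurableSet_generateFrom hD
      dsimp only
      rw [(hval D E hDm hE).1, (hval D E hDm hE).2]
      rcases hD with ⟨A, hA, rfl⟩ | ⟨i, A, hA, rfl⟩
      -- Rectangles based at time `0` are null on both sides, by `hμ0`.
      · have hz : ∀ (ω : Ω), {z : ℝ≥0 × Space d × Space d | (z.1, ω) ∈ ({⊥} : Set ℝ≥0) ×ˢ A ∧
            z.2 ∈ E ∧ z ∈ cells μ n} ⊆ {0} ×ˢ univ := by
          rintro ω z ⟨⟨h1, -⟩, -⟩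
          exact ⟨h1, mem_univ _⟩
        have h1 : ∫⁻ ω, N ω {z | (z.1, ω) ∈ ({⊥} : Set ℝ≥0) ×ˢ A ∧
            z.2 ∈ E ∧ z ∈ cells μ n} ∂P = 0 := by
          refine lintegral_eq_zero_of_ae_eq_zero ?_
          filter_upwards [hN.ae_eq_zero ((measurableSet_singleton 0).prod MeasurableSet.univ) hμ0]
            with ω hω
          exact measure_mono_null (hz ω) hω
        rw [h1, eq_comm]
        refine lintegral_eq_zero_of_ae_eq_zero (Eventually.of_forall fun ω => ?_)
        exact measure_mono_null (hz ω) hμ0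
      · set B : Set (ℝ≥0 × Space d × Space d) := (Ioi i ×ˢ E) ∩ cells μ n with hBdef
        have hB : MeasurableSet B := (measurableSet_Ioi.prod hE).inter (measurableSet_cells μ n)
        have hBi : B ⊆ Ioi i ×ˢ univ := fun z hz => ⟨hz.1.1, mem_univ _⟩
        have hBμ : μ B ≠ ∞ := hfinS B inter_subset_right
        classical
        have hs : ∀ (ω : Ω), {z : ℝ≥0 × Space d × Space d | (z.1, ω) ∈ Ioi i ×ˢ A ∧
            z.2 ∈ E ∧ z ∈ cells μ n} = if ω ∈ A then B else ∅ := by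
          intro ω
          ext z
          by_cases h : ω ∈ A <;> simp [h, hBdef, and_assoc]
        have e1 : ∀ (Q : Ω → Measure (ℝ≥0 × Space d × Space d)) (ω : Ω),
            Q ω {z : ℝ≥0 × Space d × Space d | (z.1, ω) ∈ Ioi i ×ˢ A ∧
            z.2 ∈ E ∧ z ∈ cells μ n} = A.indicator (fun ω => Q ω B) ω := by
          intro Q ω
          rw [hs]
          by_cases h : ω ∈ A <;> simp [h]
        simp only [e1 N, e1 fun _ => μ]
        rw [hN.lintegral_indicator i hB hBi hBμ hA, lintegral_indicator_const (ℱ.le _ _ hA),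
          mul_comm]
    · rw [hu.1, hu.2]
  have h1 := @lintegral_map _ _ _ (ℱ.predictable.prod inferInstance)
    ((P ⊗ₘ κ).restrict (S n)) f shuffle hf hφ
  have h2 := @lintegral_map _ _ _ (ℱ.predictable.prod inferInstance)
    ((P.prod μ).restrict (S n)) f shuffle hf hφ
  simp only [Function.comp_apply]
  rw [← h1, ← h2, key]

end Campbell

/-! ### The intensity -/

section Intensity

/-- Lebesgue measure on the time axis `ℝ_+`. -/
abbrev timeMeasure : Measure ℝ≥0 := (volume : Measure ℝ).comap ((↑) : ℝ≥0 → ℝ)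

theorem measurableEmbedding_coe_nnreal : MeasurableEmbedding ((↑) : ℝ≥0 → ℝ) :=
  MeasurableEmbedding.subtype_coe measurableSet_Ici

theorem map_timeMeasure : timeMeasure.map ((↑) : ℝ≥0 → ℝ) = volume.restrict (Ici 0) := by
  rw [measurableEmbedding_coe_nnreal.map_comap]
  congr 1
  ext r
  exact ⟨fun ⟨s, hs⟩ => hs ▸ s.2, fun hr => ⟨⟨r, hr⟩, rfl⟩⟩

instance : SigmaFinite timeMeasure := by
  have : SigmaFinite (timeMeasure.map ((↑) : ℝ≥0 → ℝ)) := by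
    rw [map_timeMeasure]; infer_instance
  exact SigmaFinite.of_map _ measurableEmbedding_coe_nnreal.measurable.aemeasurable this

theorem timeMeasure_singleton (t : ℝ≥0) : timeMeasure {t} = 0 := by
  rw [measurableEmbedding_coe_nnreal.comap_apply, image_singleton, Real.volume_singleton]

theorem setLIntegral_timeMeasure (t : ℝ≥0) (f : ℝ → ℝ≥0∞) :
    ∫⁻ s in Ioc 0 t, f s ∂timeMeasure = ∫⁻ r in Ioc 0 (t : ℝ), f r := by
  have h1 : timeMeasure.restrict (Ioc 0 t) =
      timeMeasure.restrict (((↑) : ℝ≥0 → ℝ) ⁻¹' (Ioc 0 (t : ℝ))) := by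
    congr 1
  rw [h1, ← measurableEmbedding_coe_nnreal.lintegral_map, ← Measure.restrict_map
    measurableEmbedding_coe_nnreal.measurable measurableSet_Ioc, map_timeMeasure,
    Measure.restrict_restrict measurableSet_Ioc]
  congr 2
  ext r
  simp only [mem_inter_iff, mem_Ioc, mem_Ici]
  exact ⟨fun h => h.1, fun h => ⟨h, h.1.le⟩⟩

/-- Extending the integral to `(-∞, t]` gives the clean factor `1/b`, which is what makes the mild
map contract for large `b`. -/
theorem setLIntegral_exp_timeMeasure_le {b : ℝ} (hb : 0 < b) (t : ℝ≥0) :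
    ∫⁻ s in Ioc 0 t, ENNReal.ofReal (Real.exp (b * s)) ∂timeMeasure ≤
      ENNReal.ofReal (Real.exp (b * t) / b) := by
  rw [setLIntegral_timeMeasure t (fun r => ENNReal.ofReal (Real.exp (b * r)))]
  have hint : IntegrableOn (fun r => Real.exp (b * r)) (Iic (t : ℝ)) :=
    integrableOn_exp_mul_Iic hb _
  calc _ ≤ ∫⁻ r in Iic (t : ℝ), ENNReal.ofReal (Real.exp (b * r)) :=
        lintegral_mono_set Ioc_subset_Iic_self
    _ = ENNReal.ofReal (∫ r in Iic (t : ℝ), Real.exp (b * r)) := by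
        rw [ofReal_integral_eq_lintegral_ofReal hint
          (Eventually.of_forall fun r => (Real.exp_pos _).le)]
    _ = _ := by rw [integral_exp_mul_Iic hb]

/-- The measure `J ν` is finite, and `ν` has the finite density `1/J` with respect to it. -/
theorem sigmaFinite_of_lintegral_lt_top {X : Type*} [MeasurableSpace X] {ν : Measure X}
    {J : X → ℝ} (hJ : Measurable J) (hpos : ∀ h, 0 < J h)
    (hint : ∫⁻ h, ENNReal.ofReal (J h) ∂ν ≠ ∞) : SigmaFinite ν := by
  have hm : Measurable fun h => ENNReal.ofReal (J h) := hJ.ennreal_ofReal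
  have hne : ∀ h, ENNReal.ofReal (J h) ≠ 0 := fun h => by simpa using hpos h
  have h1 := withDensity_inv_same hm (μ := ν) (Eventually.of_forall hne)
    (Eventually.of_forall fun h => ENNReal.ofReal_ne_top)
  have := isFiniteMeasure_withDensity hint
  rw [← h1]
  exact SigmaFinite.withDensity_of_ne_top (Eventually.of_forall fun h => by simpa using hpos h)

variable {d : ℕ} {ν : Measure (Space d)}

instance [SigmaFinite ν] : SigmaFinite (intensity ν) :=
  inferInstanceAs (SigmaFinite (timeMeasure.prod ((volume : Measure (Space d)).prod ν)))

theorem intensity_singleton_prod [SigmaFinite ν] (t : ℝ≥0) :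
    intensity ν ({t} ×ˢ univ) = 0 := by
  rw [intensity, Measure.prod_prod, timeMeasure_singleton, zero_mul]

/-- This discards the endpoint `s = t`, where `stableDensity α (t - s)` is evaluated at time zero
and has no meaning. -/
theorem Ioo_prod_ae_eq {m : Measure (ℝ≥0 × Space d × Space d)} {t : ℝ≥0}
    (h : m ({t} ×ˢ univ) = 0) :
    (Ioo 0 t ×ˢ univ : Set (ℝ≥0 × Space d × Space d)) =ᵐ[m] Ioc 0 t ×ˢ univ := by
  have : ∀ᵐ z ∂m, z ∉ ({t} ×ˢ univ : Set (ℝ≥0 × Space d × Space d)) := by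
    exact measure_eq_zero_iff_ae_notMem.1 h
  filter_upwards [this] with z hz
  have hz : z.1 ≠ t := fun h => hz ⟨h, mem_univ _⟩
  apply propext
  change (z ∈ Ioo 0 t ×ˢ univ) ↔ (z ∈ Ioc 0 t ×ˢ univ)
  simp only [mem_prod, mem_Ioo, mem_Ioc, mem_univ, and_true]
  exact ⟨fun h => ⟨h.1, h.2.le⟩, fun h => ⟨h.1, lt_of_le_of_ne h.2 hz⟩⟩

/-- The jump variable integrates to `∫ J dν` and the spatial variable to one, by the unit mass of
the kernel; only the time integral of the weight remains. -/
theorem setLIntegral_intensity_le [SigmaFinite ν] (hd : 0 < d) {α : ℝ} (hα : 0 < α)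
    (hα2 : α ≤ 2) {J : Space d → ℝ} (hJ : Measurable J) {t : ℝ≥0} {x : Space d}
    {f : ℝ≥0 × Space d × Space d → ℝ≥0∞} {w : ℝ≥0 → ℝ≥0∞} (hw : Measurable w)
    (hf : ∀ z, 0 < z.1 → z.1 < t → f z ≤ ‖stableDensity α ((t : ℝ) - z.1) (x - z.2.1)‖ₑ *
      ENNReal.ofReal (J z.2.2) * w z.1) :
    ∫⁻ z in Ioc 0 t ×ˢ univ, f z ∂(intensity ν) ≤
      (∫⁻ h, ENNReal.ofReal (J h) ∂ν) * ∫⁻ s in Ioc 0 t, w s ∂timeMeasure := by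
  rw [← setLIntegral_congr (Ioo_prod_ae_eq (intensity_singleton_prod t))]
  have hp : Measurable fun z : ℝ≥0 × Space d × Space d =>
      ‖stableDensity α ((t : ℝ) - z.1) (x - z.2.1)‖ₑ * ENNReal.ofReal (J z.2.2) * w z.1 := by
    have h1 : Measurable fun z : ℝ≥0 × Space d × Space d =>
        stableDensity α ((t : ℝ) - z.1) (x - z.2.1) :=
      (measurable_stableDensity d α).comp (f := fun z : ℝ≥0 × Space d × Space d =>
        ((t : ℝ) - z.1, x - z.2.1)) (by fun_prop)
    exact (h1.enorm.mul (by fun_prop)).mul (by fun_prop)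
  calc _ ≤ ∫⁻ z in Ioo 0 t ×ˢ univ, ‖stableDensity α ((t : ℝ) - z.1) (x - z.2.1)‖ₑ *
        ENNReal.ofReal (J z.2.2) * w z.1 ∂(intensity ν) :=
        setLIntegral_mono hp fun z hz => hf z hz.1.1 hz.1.2
    _ = ∫⁻ s in Ioo 0 t, (∫⁻ h, ENNReal.ofReal (J h) ∂ν) * w s ∂timeMeasure := by
        rw [intensity, ← Measure.prod_restrict, Measure.restrict_univ,
          lintegral_prod _ hp.aemeasurable]
        refine setLIntegral_congr_fun measurableSet_Ioo fun s hs => ?_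
        have hpos : (0 : ℝ) < (t : ℝ) - s := sub_pos.2 (by exact_mod_cast hs.2)
        have hm : Measurable fun y : Space d => ‖stableDensity α ((t : ℝ) - s) (x - y)‖ₑ :=
          ((measurable_stableDensity_right d α ((t : ℝ) - s)).comp
            (measurable_const.sub measurable_id)).enorm
        change ∫⁻ y : Space d × Space d, ‖stableDensity α ((t : ℝ) - s) (x - y.1)‖ₑ *
          ENNReal.ofReal (J y.2) * w s ∂(volume.prod ν) = _
        rw [lintegral_mul_const _ (by
            exact (hm.comp measurable_fst).mul (hJ.ennreal_ofReal.comp measurable_snd)),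
          lintegral_prod_mul hm.aemeasurable hJ.ennreal_ofReal.aemeasurable,
          lintegral_enorm_stableDensity_sub hd hα hα2 hpos, one_mul]
    _ ≤ ∫⁻ s in Ioc 0 t, (∫⁻ h, ENNReal.ofReal (J h) ∂ν) * w s ∂timeMeasure :=
        lintegral_mono_set Ioo_subset_Ioc_self
    _ = _ := lintegral_const_mul _ hw

end Intensity

/-! ### Predictability of the Poisson integral -/

section Predictable

variable {d : ℕ} {Ω : Type*} [mΩ : MeasurableSpace Ω]
  {N : Ω → Measure (ℝ≥0 × Space d × Space d)} {μ : Measure (ℝ≥0 × Space d × Space d)}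
  {P : Measure Ω}

theorem measurable_fst_predictable (ℱ : Filtration ℝ≥0 mΩ) :
    Measurable[ℱ.predictable] (Prod.fst : ℝ≥0 × Ω → ℝ≥0) := by
  refine @measurable_of_Ioi _ _ _ _ _ ℱ.predictable _ _ _ _ fun i => ?_
  have : (Prod.fst ⁻¹' Ioi i : Set (ℝ≥0 × Ω)) = Ioi i ×ˢ univ := by ext; simp
  rw [this]
  exact measurableSet_predictable_Ioi_prod MeasurableSet.univ

/-- For `i < s < t` and `A` in `ℱ i`, the condition `ω ∈ A` can be read off from `(t, ω) ∈ (i, ∞) ×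
A`. Thus a field evaluated at times strictly before `t` is predictable in `(t, ω)`. The value `0`
for `s ≥ t` is harmless, since the noise kernel is carried by `s < t`. -/
theorem measurable_clip_predictable (ℱ : Filtration ℝ≥0 mΩ) :
    @Measurable _ _ (ℱ.predictable.prod inferInstance) ℱ.predictable
      (fun p : (ℝ≥0 × Ω) × ℝ≥0 => ((if p.2 < p.1.1 then p.2 else 0, p.1.2) : ℝ≥0 × Ω)) := by
  have hfst : @Measurable _ _ (ℱ.predictable.prod inferInstance) ℱ.predictable
      (Prod.fst : (ℝ≥0 × Ω) × ℝ≥0 → ℝ≥0 × Ω) := @measurable_fst _ _ ℱ.predictable _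
  have hsnd : @Measurable _ _ (ℱ.predictable.prod inferInstance) _
      (Prod.snd : (ℝ≥0 × Ω) × ℝ≥0 → ℝ≥0) := @measurable_snd _ _ ℱ.predictable _
  have htime : @Measurable _ _ (ℱ.predictable.prod inferInstance) _
      (fun p : (ℝ≥0 × Ω) × ℝ≥0 => p.1.1) :=
    @Measurable.comp _ _ _ (_) ℱ.predictable _ _ _ (measurable_fst_predictable ℱ) hfst
  have hlt : MeasurableSet[ℱ.predictable.prod inferInstance]
      {p : (ℝ≥0 × Ω) × ℝ≥0 | p.2 < p.1.1} :=
    @measurableSet_lt _ _ _ _ _ (ℱ.predictable.prod inferInstance) _ _ _ _ _ hsnd htime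
  refine @measurable_generateFrom _ _ (ℱ.predictable.prod inferInstance) _ _ ?_
  rintro _ (⟨A, hA, rfl⟩ | ⟨i, A, hA, rfl⟩)
  -- The clipped time can vanish at any `t`, so the whole cylinder over `A` must be predictable; it
  -- is, because `A` belongs to `ℱ ⊥`.
  · have hu : MeasurableSet[ℱ.predictable] (univ ×ˢ A : Set (ℝ≥0 × Ω)) := by
      have : (univ ×ˢ A : Set (ℝ≥0 × Ω)) = {⊥} ×ˢ A ∪ Ioi ⊥ ×ˢ A := by
        rw [← union_prod]
        congr 1
        ext s
        simp
      rw [this]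
      exact (measurableSet_predictable_singleton_bot_prod hA).union
        (measurableSet_predictable_Ioi_prod hA)
    have : (fun p : (ℝ≥0 × Ω) × ℝ≥0 => ((if p.2 < p.1.1 then p.2 else 0, p.1.2) : ℝ≥0 × Ω)) ⁻¹'
        ({⊥} ×ˢ A) = Prod.fst ⁻¹' (univ ×ˢ A) ∩
          ({p | p.2 < p.1.1}ᶜ ∪ Prod.snd ⁻¹' {0}) := by
      ext ⟨⟨t, ω⟩, s⟩
      by_cases h : s < t <;> simp [h, and_comm]
    rw [this]
    exact (hfst hu).inter (hlt.compl.union (hsnd (measurableSet_singleton 0)))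
  · have : (fun p : (ℝ≥0 × Ω) × ℝ≥0 => ((if p.2 < p.1.1 then p.2 else 0, p.1.2) : ℝ≥0 × Ω)) ⁻¹'
        (Ioi i ×ˢ A) = Prod.fst ⁻¹' (Ioi i ×ˢ A) ∩
          ({p | p.2 < p.1.1} ∩ Prod.snd ⁻¹' (Ioi i)) := by
      ext ⟨⟨t, ω⟩, s⟩
      by_cases h : s < t
      · simp only [h, mem_preimage, if_true, mem_prod, mem_Ioi, mem_inter_iff, mem_ofPred_eq,
          true_and]
        exact ⟨fun hh => ⟨⟨hh.1.trans h, hh.2⟩, hh.1⟩, fun hh => ⟨hh.2, hh.1.2⟩⟩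
      · simp [h]
    rw [this]
    exact (hfst (measurableSet_predictable_Ioi_prod hA)).inter
      (hlt.inter (hsnd measurableSet_Ioi))

/-- By continuity from below, the mass before `t` is the supremum over dense times `r < t` of the
mass up to `r`. Each term lives on `t > r` and is known at time `r`, which is predictable. -/
theorem measurable_restrict_Iio_noise (hN : Measurable N) :
    Measurable[(noiseFiltration N hN P).predictable]
      (fun q : ℝ≥0 × Ω => (N q.2).restrict (Iio q.1 ×ˢ univ)) := by
  set ℱ := noiseFiltration N hN P with hℱ
  refine @Measure.measurable_of_measurable_coe _ _ _ ℱ.predictable _ fun C hC => ?_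
  set r : ℕ → ℝ≥0 := TopologicalSpace.denseSeq ℝ≥0 with hr
  have hCr : ∀ n, MeasurableSet (C ∩ Iic (r n) ×ˢ univ) :=
    fun n => hC.inter (measurableSet_Iic.prod MeasurableSet.univ)
  classical
  have e : ∀ q : ℝ≥0 × Ω, (N q.2).restrict (Iio q.1 ×ˢ univ) C =
      ⨆ n, (Ioi (r n) ×ˢ (univ : Set Ω)).indicator
        (fun q => N q.2 (C ∩ Iic (r n) ×ˢ univ)) q := by
    rintro ⟨t, ω⟩
    rw [Measure.restrict_apply hC]
    set A : ℕ → Set (ℝ≥0 × Space d × Space d) := fun n =>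
      if r n < t then C ∩ Iic (r n) ×ˢ univ else ∅ with hA
    have hU : C ∩ Iio t ×ˢ univ = ⋃ n, A n := by
      ext z
      simp only [mem_iUnion, hA]
      constructor
      · rintro ⟨h1, h2, -⟩
        obtain ⟨_, ⟨n, rfl⟩, hn1, hn2⟩ :=
          (TopologicalSpace.denseRange_denseSeq ℝ≥0).exists_between (show z.1 < t from h2)
        refine ⟨n, ?_⟩
        rw [if_pos hn2]
        exact ⟨h1, hn1.le, mem_univ _⟩
      · rintro ⟨n, hn⟩
        split_ifs at hn with h
        · exact ⟨hn.1, lt_of_le_of_lt (show z.1 ≤ r n from hn.2.1) h, mem_univ _⟩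
        · exact hn.elim
    have hdir : Directed (· ⊆ ·) A := by
      intro i j
      by_cases hi : r i < t
      · by_cases hj : r j < t
        · rcases le_total (r i) (r j) with h | h
          · refine ⟨j, ?_, subset_rfl⟩
            simp only [hA, hi, hj, if_true]
            exact inter_subset_inter_right _ (prod_mono (Iic_subset_Iic.2 h) subset_rfl)
          · refine ⟨i, subset_rfl, ?_⟩
            simp only [hA, hi, hj, if_true]
            exact inter_subset_inter_right _ (prod_mono (Iic_subset_Iic.2 h) subset_rfl)
        · exact ⟨i, subset_rfl, by simp [hA, hj]⟩
      · exact ⟨j, by simp [hA, hi], subset_rfl⟩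
    rw [hU, hdir.measure_iUnion]
    refine iSup_congr fun n => ?_
    by_cases h : r n < t <;> simp [hA, h]
  simp only [e]
  refine @Measurable.iSup _ _ _ _ _ ℱ.predictable _ _ _ _ _ _ fun n => ?_
  refine @measurable_of_Ioi _ _ _ _ _ ℱ.predictable _ _ _ _ fun a => ?_
  have hpre : ((Ioi (r n) ×ˢ (univ : Set Ω)).indicator
      (fun q : ℝ≥0 × Ω => N q.2 (C ∩ Iic (r n) ×ˢ univ))) ⁻¹' Ioi a =
      Ioi (r n) ×ˢ ((fun ω => N ω (C ∩ Iic (r n) ×ˢ univ)) ⁻¹' Ioi a) := by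
    ext ⟨t, ω⟩
    by_cases h : r n < t <;> simp [h]
  rw [hpre]
  exact measurableSet_predictable_Ioi_prod
    (measurable_noiseFiltration_apply hN (r n) (hCr n) inter_subset_right measurableSet_Ioi)

/-- The noise before time `t`, as an s-finite kernel for the predictable σ-algebra. -/
def noiseKernel [SigmaFinite μ] (hN : IsPoissonRandomMeasure N μ P) :
    @Kernel (ℝ≥0 × Ω) (ℝ≥0 × Space d × Space d)
      (noiseFiltration N hN.measurable P).predictable _ :=
  @regularKernel _ _ _ (noiseFiltration N hN.measurable P).predictable _
    (measurable_restrict_Iio_noise hN.measurable) (cells μ) (measurableSet_cells μ)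

theorem isSFiniteKernel_noiseKernel [SigmaFinite μ] (hN : IsPoissonRandomMeasure N μ P) :
    @IsSFiniteKernel _ _ (noiseFiltration N hN.measurable P).predictable _ (noiseKernel hN) :=
  @isSFiniteKernel_regularKernel _ _ _ (noiseFiltration N hN.measurable P).predictable _ _ _ _
    (disjoint_cells μ) (iUnion_cells μ)

theorem noiseKernel_zero [SigmaFinite μ] (hN : IsPoissonRandomMeasure N μ P) (ω : Ω) :
    noiseKernel hN (0, ω) = 0 := by
  have : (Iio (0 : ℝ≥0) ×ˢ univ : Set (ℝ≥0 × Space d × Space d)) = ∅ := by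
    ext; simp
  refine (@regularKernel_apply _ _ _ (noiseFiltration N hN.measurable P).predictable _ _ _ _
    (0, ω) fun n => ?_).trans ?_
  · simp only [this, Measure.restrict_empty, Measure.coe_zero, Pi.zero_apply, ENNReal.zero_lt_top]
  · simp only [this, Measure.restrict_empty]

theorem ae_noiseKernel_eq [IsProbabilityMeasure P] [SigmaFinite μ]
    (hN : IsPoissonRandomMeasure N μ P) :
    ∀ᵐ ω ∂P, ∀ t, noiseKernel hN (t, ω) = (N ω).restrict (Iio t ×ˢ univ) := by
  filter_upwards [hN.ae_cells_lt_top] with ω hω t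
  exact @regularKernel_apply _ _ _ (noiseFiltration N hN.measurable P).predictable _ _ _ _
    (t, ω) fun n => (Measure.restrict_apply_le _ _).trans_lt (hω n)

/-- The parameter space `T` is kept abstract so that `ℝ≥0 × Ω` with its predictable σ-algebra can be
substituted for it. -/
theorem measurable_integral_mild {T : Type*} [MeasurableSpace T]
    (κ : Kernel T (ℝ≥0 × Space d × Space d)) [IsSFiniteKernel κ] {τ : T → ℝ≥0}
    (hτ : Measurable τ) {U : (T × ℝ≥0) × Space d → ℝ} (hU : Measurable U) (α : ℝ)
    {σ : ℝ → Space d → ℝ} (hσ : Measurable (Function.uncurry σ)) :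
    Measurable fun p : T × Space d => ∫ z, stableDensity α ((τ p.1 : ℝ) - z.1) (p.2 - z.2.1) *
      σ (U ((p.1, z.1), z.2.1)) z.2.2 ∂(κ p.1) := by
  have h1 : Measurable fun q : (T × Space d) × ℝ≥0 × Space d × Space d =>
      stableDensity α ((τ q.1.1 : ℝ) - q.2.1) (q.1.2 - q.2.2.1) :=
    (measurable_stableDensity d α).comp (f := fun q : (T × Space d) × ℝ≥0 × Space d × Space d =>
      ((τ q.1.1 : ℝ) - q.2.1, q.1.2 - q.2.2.1)) (by fun_prop)
  have h2 : Measurable fun q : (T × Space d) × ℝ≥0 × Space d × Space d =>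
      σ (U ((q.1.1, q.2.1), q.2.2.1)) q.2.2.2 :=
    hσ.comp (f := fun q : (T × Space d) × ℝ≥0 × Space d × Space d =>
      (U ((q.1.1, q.2.1), q.2.2.1), q.2.2.2)) (by fun_prop)
  have h3 := (h1.mul h2).stronglyMeasurable.integral_kernel_prod_right'
    (κ := κ.comap Prod.fst measurable_fst)
  exact h3.measurable

end Predictable

/-! ### The mild map -/

section MildMap

variable {d : ℕ} {Ω : Type*} [mΩ : MeasurableSpace Ω]
  {N : Ω → Measure (ℝ≥0 × Space d × Space d)} {P : Measure Ω} {ν : Measure (Space d)}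
  {α lam K Lip b : ℝ} {σ : ℝ → Space d → ℝ} {u₀ J : Space d → ℝ}
  {u v : ℝ≥0 → Space d → Ω → ℝ}

theorem IsPredictableField.measurable {ℱ : Filtration ℝ≥0 mΩ} (hu : IsPredictableField ℱ u)
    (t : ℝ≥0) (x : Space d) : Measurable (u t x) := by
  have h : Measurable (fun q : (ℝ≥0 × Ω) × Space d => u q.1.1 q.2 q.1.2) :=
    Measurable.mono hu (sup_le_sup_right (MeasurableSpace.comap_mono (predictable_le ℱ)) _) le_rfl
  exact h.comp (f := fun ω : Ω => ((t, ω), x)) (by fun_prop)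

/-- The right-hand side of the mild formulation, as a map on predictable random fields. The noise
enters through the points with time in `[0, t)`, which makes the image predictable. -/
def mildMap [SigmaFinite ν] (hN : IsPoissonRandomMeasure N (intensity ν) P) (α lam : ℝ)
    (σ : ℝ → Space d → ℝ) (u₀ : Space d → ℝ) (u : ℝ≥0 → Space d → Ω → ℝ) :
    ℝ≥0 → Space d → Ω → ℝ := fun t x ω =>
  (if t = 0 then u₀ x else ∫ y, stableDensity α t (x - y) * u₀ y) +
    lam * ∫ z, stableDensity α ((t : ℝ) - z.1) (x - z.2.1) *
      σ (u (if z.1 < t then z.1 else 0) z.2.1 ω) z.2.2 ∂(noiseKernel hN (t, ω))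

theorem measurable_mild_field {T : Type*} [MeasurableSpace T]
    (κ : Kernel T (ℝ≥0 × Space d × Space d)) [IsSFiniteKernel κ] {τ : T → ℝ≥0}
    (hτ : Measurable τ) {c : T × ℝ≥0 → T} (hc : Measurable c) {w : T × Space d → ℝ}
    (hw : Measurable w) (hσ : Measurable (Function.uncurry σ)) (hu₀ : Measurable u₀) :
    Measurable fun p : T × Space d =>
      (if τ p.1 = 0 then u₀ p.2 else ∫ y, stableDensity α (τ p.1) (p.2 - y) * u₀ y) +
        lam * ∫ z, stableDensity α ((τ p.1 : ℝ) - z.1) (p.2 - z.2.1) *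
          σ (w (c (p.1, z.1), z.2.1)) z.2.2 ∂(κ p.1) := by
  refine Measurable.add ?_ (Measurable.const_mul ?_ _)
  · refine Measurable.ite ((hτ.comp measurable_fst) (measurableSet_singleton 0))
      (by fun_prop) ?_
    have h1 : Measurable fun q : (T × Space d) × Space d =>
        stableDensity α (τ q.1.1) (q.1.2 - q.2) :=
      (measurable_stableDensity d α).comp (f := fun q : (T × Space d) × Space d =>
        ((τ q.1.1 : ℝ), q.1.2 - q.2)) (by fun_prop)
    have h2 : Measurable fun q : (T × Space d) × Space d =>
        stableDensity α (τ q.1.1) (q.1.2 - q.2) * u₀ q.2 := h1.mul (by fun_prop)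
    exact (h2.stronglyMeasurable.integral_prod_right' (ν := volume)).measurable
  · exact measurable_integral_mild κ hτ
      (U := fun p : (T × ℝ≥0) × Space d => w (c p.1, p.2)) (by fun_prop) α hσ

theorem isPredictableField_mildMap [SigmaFinite ν]
    (hN : IsPoissonRandomMeasure N (intensity ν) P) (hσ : Measurable (Function.uncurry σ))
    (hu₀ : Measurable u₀) (hu : IsPredictableField (noiseFiltration N hN.measurable P) u) :
    IsPredictableField (noiseFiltration N hN.measurable P) (mildMap hN α lam σ u₀ u) :=
  @measurable_mild_field d α lam σ u₀ (ℝ≥0 × Ω) (noiseFiltration N hN.measurable P).predictable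
    (noiseKernel hN) (isSFiniteKernel_noiseKernel hN) Prod.fst (measurable_fst_predictable _) _
    (measurable_clip_predictable _) _ hu hσ hu₀

theorem mildMap_zero [SigmaFinite ν] (hN : IsPoissonRandomMeasure N (intensity ν) P)
    (x : Space d) (ω : Ω) : mildMap hN α lam σ u₀ u 0 x ω = u₀ x := by
  simp [mildMap, noiseKernel_zero]

/-- The map and the mild formulation differ only through points of the noise at times `0` and `t`,
almost surely absent; at times before `t` the clipping does nothing. -/
theorem ae_mildMap_eq [IsProbabilityMeasure P] [SigmaFinite ν]
    (hN : IsPoissonRandomMeasure N (intensity ν) P) {t : ℝ≥0} (ht : 0 < t) (x : Space d) :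
    ∀ᵐ ω ∂P, mildMap hN α lam σ u₀ u t x ω =
      (∫ y, stableDensity α t (x - y) * u₀ y) +
        lam * poissonIntegral N t (mildIntegrand α σ u t x) ω := by
  have hnull : ∀ s : ℝ≥0, ∀ᵐ ω ∂P, N ω ({s} ×ˢ univ) = 0 := fun s =>
    hN.ae_eq_zero ((measurableSet_singleton s).prod MeasurableSet.univ)
      (intensity_singleton_prod s)
  filter_upwards [ae_noiseKernel_eq hN, hnull 0, hnull t] with ω h1 h2 h3
  have h4 : (Iio t ×ˢ univ : Set (ℝ≥0 × Space d × Space d)) =ᵐ[N ω] Ioo 0 t ×ˢ univ := by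
    filter_upwards [measure_eq_zero_iff_ae_notMem.1 h2] with z hz
    have hz : 0 < z.1 := pos_iff_ne_zero.2 fun h => hz ⟨h, mem_univ _⟩
    apply propext
    change (z ∈ Iio t ×ˢ univ) ↔ (z ∈ Ioo 0 t ×ˢ univ)
    simp [hz]
  simp only [mildMap, ht.ne', if_false, poissonIntegral]
  rw [h1, Measure.restrict_congr_set h4, ← Measure.restrict_congr_set (Ioo_prod_ae_eq h3)]
  congr 2
  refine setIntegral_congr_fun (measurableSet_Ioo.prod MeasurableSet.univ) fun z hz => ?_
  have : z.1 < t := hz.1.2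
  simp [mildIntegrand, this]

theorem measurable_mildIntegrand {ℱ : Filtration ℝ≥0 mΩ} (hσ : Measurable (Function.uncurry σ))
    (hu : IsPredictableField ℱ u) (t : ℝ≥0) (x : Space d) :
    Measurable[ℱ.predictable.prod inferInstance]
      (fun q : (ℝ≥0 × Ω) × Space d × Space d =>
        mildIntegrand α σ u t x q.1.1 q.2.1 q.2.2 q.1.2) := by
  have key : ∀ {T : Type _} [MeasurableSpace T] {τ : T → ℝ≥0} (_ : Measurable τ)
      {U : T × Space d → ℝ} (_ : Measurable U), Measurable fun q : T × Space d × Space d =>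
        stableDensity α ((t : ℝ) - τ q.1) (x - q.2.1) * σ (U (q.1, q.2.1)) q.2.2 := by
    intro T _ τ hτ U hU
    have h1 : Measurable fun q : T × Space d × Space d =>
        stableDensity α ((t : ℝ) - τ q.1) (x - q.2.1) :=
      (measurable_stableDensity d α).comp (f := fun q : T × Space d × Space d =>
        ((t : ℝ) - τ q.1, x - q.2.1)) (by fun_prop)
    exact h1.mul (hσ.comp (f := fun q : T × Space d × Space d =>
      (U (q.1, q.2.1), q.2.2)) (by fun_prop))
  exact @key (ℝ≥0 × Ω) ℱ.predictable Prod.fst (measurable_fst_predictable ℱ) _ hu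

/-- Campbell's formula up to time `t`. -/
theorem lintegral_setLIntegral_noise [IsProbabilityMeasure P] [SigmaFinite ν]
    (hN : IsPoissonRandomMeasure N (intensity ν) P) (t : ℝ≥0)
    {f : (ℝ≥0 × Ω) × Space d × Space d → ℝ≥0∞}
    (hf : Measurable[(noiseFiltration N hN.measurable P).predictable.prod inferInstance] f) :
    ∫⁻ ω, ∫⁻ z in Ioc 0 t ×ˢ univ, f ((z.1, ω), z.2) ∂(N ω) ∂P =
      ∫⁻ z in Ioc 0 t ×ˢ univ, ∫⁻ ω, f ((z.1, ω), z.2) ∂P ∂(intensity ν) := by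
  set ℱ := noiseFiltration N hN.measurable P with hℱ
  have hS : MeasurableSet (Ioc 0 t ×ˢ univ : Set (ℝ≥0 × Space d × Space d)) :=
    measurableSet_Ioc.prod MeasurableSet.univ
  have hS' : MeasurableSet[ℱ.predictable.prod (inferInstance : MeasurableSpace (Space d × Space d))]
      ((fun q : (ℝ≥0 × Ω) × Space d × Space d => q.1.1) ⁻¹' Ioc 0 t) :=
    (@Measurable.comp _ _ _ (_) ℱ.predictable _ _ _ (measurable_fst_predictable ℱ)
      (@measurable_fst _ _ ℱ.predictable _)) measurableSet_Ioc
  have h := hN.lintegral_lintegral_predictable (intensity_singleton_prod 0)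
    (@Measurable.indicator _ _ (_) _ _ _ _ hf hS')
  have e : ∀ (z : ℝ≥0 × Space d × Space d) (ω : Ω),
      ((fun q : (ℝ≥0 × Ω) × Space d × Space d => q.1.1) ⁻¹' Ioc 0 t).indicator f
        ((z.1, ω), z.2) =
      (Ioc 0 t ×ˢ univ : Set (ℝ≥0 × Space d × Space d)).indicator
        (fun z => f ((z.1, ω), z.2)) z := by
    intro z ω
    by_cases hz : z.1 ∈ Ioc 0 t <;> simp [indicator, hz]
  have e2 : ∀ z : ℝ≥0 × Space d × Space d,
      ∫⁻ ω, (Ioc 0 t ×ˢ univ : Set (ℝ≥0 × Space d × Space d)).indicator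
        (fun z => f ((z.1, ω), z.2)) z ∂P =
      (Ioc 0 t ×ˢ univ : Set (ℝ≥0 × Space d × Space d)).indicator
        (fun z => ∫⁻ ω, f ((z.1, ω), z.2) ∂P) z := by
    intro z
    by_cases hz : z ∈ (Ioc 0 t ×ˢ univ : Set (ℝ≥0 × Space d × Space d))
    · simp only [indicator_of_mem hz]
    · simp only [indicator_of_notMem hz, lintegral_zero]
  simp only [e, e2] at h
  simpa only [lintegral_indicator hS] using h

/-- Campbell's formula for `|f|` gives a finite mean, hence almost sure finiteness. This is what
allows pathwise integrals to be subtracted. -/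
theorem ae_integrable_poissonIntegrand [IsProbabilityMeasure P] [SigmaFinite ν]
    (hN : IsPoissonRandomMeasure N (intensity ν) P) {t : ℝ≥0}
    {f : ℝ≥0 → Space d → Space d → Ω → ℝ}
    (hf : IsPoissonIntegrand (noiseFiltration N hN.measurable P) P ν t f) :
    ∀ᵐ ω ∂P, IntegrableOn (fun z => f z.1 z.2.1 z.2.2 ω) (Ioc 0 t ×ˢ univ) (N ω) := by
  set ℱ := noiseFiltration N hN.measurable P with hℱ
  have hm : Measurable fun q : Ω × ℝ≥0 × Space d × Space d => f q.2.1 q.2.2.1 q.2.2.2 q.1 :=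
    @Measurable.comp _ _ _ (_) (ℱ.predictable.prod inferInstance) _ _ _ hf.1
      (measurable_shuffle (Z := Space d × Space d) ℱ)
  have hS : MeasurableSet (Ioc 0 t ×ˢ univ : Set (ℝ≥0 × Space d × Space d)) :=
    measurableSet_Ioc.prod MeasurableSet.univ
  have hc := lintegral_setLIntegral_noise hN t
    (@Measurable.comp _ _ _ (_) _ _ _ _ measurable_enorm hf.1)
  have hfin : ∫⁻ ω, ∫⁻ z in Ioc 0 t ×ˢ univ, ‖f z.1 z.2.1 z.2.2 ω‖ₑ ∂(N ω) ∂P ≠ ∞ := by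
    refine (lt_of_eq_of_lt hc hf.2).ne
  have hSF := isSFiniteKernel_regularKernel_noise hN
  have haem : AEMeasurable
      (fun ω => ∫⁻ z in Ioc 0 t ×ˢ univ, ‖f z.1 z.2.1 z.2.2 ω‖ₑ ∂(N ω)) P := by
    set κ := regularKernel N hN.measurable (cells (intensity ν))
      (measurableSet_cells (intensity ν)) with hκ
    refine ⟨fun ω => ∫⁻ z in Ioc 0 t ×ˢ univ, ‖f z.1 z.2.1 z.2.2 ω‖ₑ ∂(κ ω), ?_, ?_⟩
    · exact Measurable.setLIntegral_kernel_prod_right (κ := κ)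
        (f := fun ω (z : ℝ≥0 × Space d × Space d) => ‖f z.1 z.2.1 z.2.2 ω‖ₑ) hm.enorm hS
    · filter_upwards [hN.ae_cells_lt_top] with ω hω
      rw [hκ, regularKernel_apply _ _ _ _ hω]
  filter_upwards [ae_lt_top' haem hfin] with ω hω
  exact ⟨(hm.comp (f := fun z : ℝ≥0 × Space d × Space d => (ω, z))
    (by fun_prop)).aestronglyMeasurable, hω⟩

theorem measurable_enorm_sub {T : Type*} [MeasurableSpace T] {f g : T → ℝ} (hf : Measurable f)
    (hg : Measurable g) : Measurable fun q => ‖f q - g q‖ₑ := (hf.sub hg).enorm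

/-- The first moment needs only the triangle inequality path by path, then Campbell's formula for
`|f - g|`. -/
theorem lintegral_enorm_poissonIntegral_sub_le [IsProbabilityMeasure P] [SigmaFinite ν]
    (hN : IsPoissonRandomMeasure N (intensity ν) P) {t : ℝ≥0}
    {f g : ℝ≥0 → Space d → Space d → Ω → ℝ}
    (hf : IsPoissonIntegrand (noiseFiltration N hN.measurable P) P ν t f)
    (hg : IsPoissonIntegrand (noiseFiltration N hN.measurable P) P ν t g) :
    ∫⁻ ω, ‖poissonIntegral N t f ω - poissonIntegral N t g ω‖ₑ ∂P ≤
      ∫⁻ z in Ioc 0 t ×ˢ univ,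
        ∫⁻ ω, ‖f z.1 z.2.1 z.2.2 ω - g z.1 z.2.1 z.2.2 ω‖ₑ ∂P ∂(intensity ν) := by
  set ℱ := noiseFiltration N hN.measurable P with hℱ
  have hc := lintegral_setLIntegral_noise hN t
    (@measurable_enorm_sub _ (_) _ _ hf.1 hg.1)
  refine le_trans (lintegral_mono_ae ?_) hc.le
  filter_upwards [ae_integrable_poissonIntegrand hN hf, ae_integrable_poissonIntegrand hN hg]
    with ω h1 h2
  rw [poissonIntegral, poissonIntegral, ← integral_sub h1 h2]
  exact enorm_integral_le_lintegral_enorm _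

theorem lintegral_enorm_poissonIntegral_le [IsProbabilityMeasure P] [SigmaFinite ν]
    (hN : IsPoissonRandomMeasure N (intensity ν) P) {t : ℝ≥0}
    {f : ℝ≥0 → Space d → Space d → Ω → ℝ}
    (hf : IsPoissonIntegrand (noiseFiltration N hN.measurable P) P ν t f) :
    ∫⁻ ω, ‖poissonIntegral N t f ω‖ₑ ∂P ≤
      ∫⁻ z in Ioc 0 t ×ˢ univ, ∫⁻ ω, ‖f z.1 z.2.1 z.2.2 ω‖ₑ ∂P ∂(intensity ν) := by
  refine le_trans (lintegral_mono fun ω => enorm_integral_le_lintegral_enorm _) ?_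
  exact (lintegral_setLIntegral_noise hN t (@Measurable.comp _ _ _ (_) _ _ _ _ measurable_enorm hf.1)).le

end MildMap

/-! ### Moment estimates -/

/-- The coefficient `σ` is Lipschitz with constants integrable against the jump measure `ν`. -/
structure IsLipschitzCoefficient {d : ℕ} (ν : Measure (Space d)) (σ : ℝ → Space d → ℝ)
    (J : Space d → ℝ) (K Lip : ℝ) : Prop where
  K_nonneg : 0 ≤ K
  Lip_nonneg : 0 ≤ Lip
  measurable : Measurable (Function.uncurry σ)
  measurable_J : Measurable J
  J_nonneg : ∀ h, 0 ≤ J h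
  lintegral_J : ∫⁻ h, ENNReal.ofReal (J h) ∂ν ≤ ENNReal.ofReal K
  zero : ∀ h, |σ 0 h| ≤ J h
  lip : ∀ x y h, |σ x h - σ y h| ≤ J h * Lip * |x - y|

/-- First moments bounded by `D e^{bt}`. -/
def MomentBound {d : ℕ} {Ω : Type*} [MeasurableSpace Ω] (P : Measure Ω) (b : ℝ) (D : ℝ≥0∞)
    (u : ℝ≥0 → Space d → Ω → ℝ) : Prop :=
  ∀ t x, ∫⁻ ω, ‖u t x ω‖ₑ ∂P ≤ D * ENNReal.ofReal (Real.exp (b * t))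

theorem one_le_ofReal_exp {b : ℝ} (hb : 0 < b) (t : ℝ≥0) :
    1 ≤ ENNReal.ofReal (Real.exp (b * t)) := by
  rw [← ENNReal.ofReal_one]
  exact ENNReal.ofReal_le_ofReal (Real.one_le_exp (by positivity))

section Estimates

variable {d : ℕ} {Ω : Type*} [mΩ : MeasurableSpace Ω]
  {N : Ω → Measure (ℝ≥0 × Space d × Space d)} {P : Measure Ω} {ν : Measure (Space d)}
  {α lam K Lip b : ℝ} {σ : ℝ → Space d → ℝ} {u₀ J : Space d → ℝ}
  {u v : ℝ≥0 → Space d → Ω → ℝ}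

theorem IsLipschitzCoefficient.enorm_sub_le (hσ : IsLipschitzCoefficient ν σ J K Lip)
    (a a' : ℝ) (h : Space d) :
    ‖σ a h - σ a' h‖ₑ ≤ ENNReal.ofReal (J h) * (ENNReal.ofReal Lip * ‖a - a'‖ₑ) := by
  rw [Real.enorm_eq_ofReal_abs, Real.enorm_eq_ofReal_abs, ← ENNReal.ofReal_mul hσ.Lip_nonneg,
    ← ENNReal.ofReal_mul (hσ.J_nonneg h), ← mul_assoc]
  exact ENNReal.ofReal_le_ofReal (hσ.lip a a' h)

theorem IsLipschitzCoefficient.enorm_le (hσ : IsLipschitzCoefficient ν σ J K Lip)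
    (a : ℝ) (h : Space d) :
    ‖σ a h‖ₑ ≤ ENNReal.ofReal (J h) * (1 + ENNReal.ofReal Lip * ‖a‖ₑ) := by
  have h1 := hσ.enorm_sub_le a 0 h
  have h2 : ‖σ 0 h‖ₑ ≤ ENNReal.ofReal (J h) := by
    rw [Real.enorm_eq_ofReal_abs]; exact ENNReal.ofReal_le_ofReal (hσ.zero h)
  calc ‖σ a h‖ₑ = ‖σ 0 h + (σ a h - σ 0 h)‖ₑ := by rw [add_sub_cancel]
    _ ≤ ‖σ 0 h‖ₑ + ‖σ a h - σ 0 h‖ₑ := enorm_add_le _ _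
    _ ≤ ENNReal.ofReal (J h) + ENNReal.ofReal (J h) * (ENNReal.ofReal Lip * ‖a - 0‖ₑ) :=
        add_le_add h2 h1
    _ = _ := by rw [sub_zero, mul_add, mul_one]

theorem lintegral_weight_le [SigmaFinite ν] (hσ : IsLipschitzCoefficient ν σ J K Lip)
    (hb : 0 < b) (t : ℝ≥0) {D : ℝ≥0∞} :
    (∫⁻ h, ENNReal.ofReal (J h) ∂ν) *
      ∫⁻ s in Ioc 0 t, D * ENNReal.ofReal (Real.exp (b * s)) ∂timeMeasure ≤
      ENNReal.ofReal (K / b) * D * ENNReal.ofReal (Real.exp (b * t)) := by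
  rw [lintegral_const_mul _ (by fun_prop)]
  calc _ ≤ ENNReal.ofReal K * (D * ENNReal.ofReal (Real.exp (b * t) / b)) := by
        gcongr
        · exact hσ.lintegral_J
        · exact setLIntegral_exp_timeMeasure_le hb t
    _ = _ := by
        rw [div_eq_mul_inv, div_eq_mul_inv, ENNReal.ofReal_mul (Real.exp_pos _).le,
          ENNReal.ofReal_mul hσ.K_nonneg]
        ring

/-- The bound `hD` is required only for times in `(0, t)`, so that the estimate also serves
uniqueness on a bounded time interval. -/
theorem lintegral_mildIntegrand_sub_le [SigmaFinite ν] (hd : 0 < d) (hα : 0 < α) (hα2 : α ≤ 2)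
    (hσ : IsLipschitzCoefficient ν σ J K Lip) (hb : 0 < b) {t : ℝ≥0} {x : Space d} {D : ℝ≥0∞}
    (hD : ∀ s y, 0 < s → s < t →
      ∫⁻ ω, ‖u s y ω - v s y ω‖ₑ ∂P ≤ D * ENNReal.ofReal (Real.exp (b * s))) :
    ∫⁻ z in Ioc 0 t ×ˢ univ, ∫⁻ ω, ‖mildIntegrand α σ u t x z.1 z.2.1 z.2.2 ω -
        mildIntegrand α σ v t x z.1 z.2.1 z.2.2 ω‖ₑ ∂P ∂(intensity ν) ≤
      ENNReal.ofReal (K * Lip / b) * D * ENNReal.ofReal (Real.exp (b * t)) := by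
  refine (setLIntegral_intensity_le (x := x) (w := fun s =>
    (ENNReal.ofReal Lip * D) * ENNReal.ofReal (Real.exp (b * s))) hd hα hα2 hσ.measurable_J
    (by fun_prop) fun z hz0 hzt => ?_).trans ?_
  · set c := ‖stableDensity α ((t : ℝ) - z.1) (x - z.2.1)‖ₑ with hc
    calc _ ≤ ∫⁻ ω, (c * ENNReal.ofReal (J z.2.2) * ENNReal.ofReal Lip) *
          ‖u z.1 z.2.1 ω - v z.1 z.2.1 ω‖ₑ ∂P := by
          refine lintegral_mono fun ω => ?_
          simp only [mildIntegrand]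
          rw [← mul_sub, enorm_mul, mul_assoc, mul_assoc]
          gcongr
          exact hσ.enorm_sub_le _ _ _
      _ = (c * ENNReal.ofReal (J z.2.2) * ENNReal.ofReal Lip) *
          ∫⁻ ω, ‖u z.1 z.2.1 ω - v z.1 z.2.1 ω‖ₑ ∂P :=
          lintegral_const_mul' _ _ (by simp [hc, ENNReal.mul_eq_top])
      _ ≤ (c * ENNReal.ofReal (J z.2.2) * ENNReal.ofReal Lip) *
          (D * ENNReal.ofReal (Real.exp (b * z.1))) := by
          gcongr
          exact hD _ _ hz0 hzt
      _ = _ := by ring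
  · refine (lintegral_weight_le hσ hb t).trans_eq ?_
    rw [mul_div_right_comm, ENNReal.ofReal_mul (div_nonneg hσ.K_nonneg hb.le)]
    ring

/-- The linear growth `|σ(a, h)| ≤ J h (1 + Lip |a|)` is used, its constant term being absorbed by
`1 ≤ e^{bs}`. -/
theorem lintegral_mildIntegrand_le [IsProbabilityMeasure P] [SigmaFinite ν] (hd : 0 < d)
    (hα : 0 < α) (hα2 : α ≤ 2)
    (hσ : IsLipschitzCoefficient ν σ J K Lip) (hb : 0 < b) {t : ℝ≥0} {x : Space d} {D : ℝ≥0∞}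
    (hD : MomentBound P b D u) :
    ∫⁻ z in Ioc 0 t ×ˢ univ,
        ∫⁻ ω, ‖mildIntegrand α σ u t x z.1 z.2.1 z.2.2 ω‖ₑ ∂P ∂(intensity ν) ≤
      ENNReal.ofReal (K / b) * (1 + ENNReal.ofReal Lip * D) *
        ENNReal.ofReal (Real.exp (b * t)) := by
  refine (setLIntegral_intensity_le (x := x) (w := fun s =>
    (1 + ENNReal.ofReal Lip * D) * ENNReal.ofReal (Real.exp (b * s))) hd hα hα2 hσ.measurable_J
    (by fun_prop) fun z hz0 hzt => ?_).trans (lintegral_weight_le hσ hb t)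
  set c := ‖stableDensity α ((t : ℝ) - z.1) (x - z.2.1)‖ₑ with hc
  calc _ ≤ ∫⁻ ω, (c * ENNReal.ofReal (J z.2.2)) *
        (1 + ENNReal.ofReal Lip * ‖u z.1 z.2.1 ω‖ₑ) ∂P := by
        refine lintegral_mono fun ω => ?_
        simp only [mildIntegrand]
        rw [enorm_mul, mul_assoc]
        gcongr
        exact hσ.enorm_le _ _
    _ = (c * ENNReal.ofReal (J z.2.2)) *
        (1 + ENNReal.ofReal Lip * ∫⁻ ω, ‖u z.1 z.2.1 ω‖ₑ ∂P) := by
        rw [lintegral_const_mul' _ _ (by simp [hc, ENNReal.mul_eq_top]),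
          lintegral_add_left measurable_const, lintegral_const_mul' _ _ ENNReal.ofReal_ne_top]
        simp
    _ ≤ (c * ENNReal.ofReal (J z.2.2)) * (ENNReal.ofReal (Real.exp (b * z.1)) +
        ENNReal.ofReal Lip * (D * ENNReal.ofReal (Real.exp (b * z.1)))) := by
        gcongr
        · exact one_le_ofReal_exp hb _
        · exact hD _ _
    _ = _ := by ring

theorem isPoissonIntegrand_mildIntegrand [IsProbabilityMeasure P] [SigmaFinite ν]
    (hN : IsPoissonRandomMeasure N (intensity ν) P) (hd : 0 < d) (hα : 0 < α) (hα2 : α ≤ 2)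
    (hσ : IsLipschitzCoefficient ν σ J K Lip) (hb : 0 < b) {D : ℝ≥0∞} (hDtop : D ≠ ∞)
    (hu : IsPredictableField (noiseFiltration N hN.measurable P) u)
    (hD : MomentBound P b D u) (t : ℝ≥0) (x : Space d) :
    IsPoissonIntegrand (noiseFiltration N hN.measurable P) P ν t (mildIntegrand α σ u t x) := by
  refine ⟨measurable_mildIntegrand hσ.measurable hu t x,
    (lintegral_mildIntegrand_le hd hα hα2 hσ hb hD).trans_lt ?_⟩
  exact ENNReal.mul_lt_top (ENNReal.mul_lt_top ENNReal.ofReal_lt_top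
    (ENNReal.add_lt_top.2 ⟨ENNReal.one_lt_top,
      ENNReal.mul_lt_top ENNReal.ofReal_lt_top hDtop.lt_top⟩)) ENNReal.ofReal_lt_top

/-- The deterministic part keeps the bound `C` because the kernel has mass one; the stochastic part
is controlled by Campbell's formula. -/
theorem momentBound_mildMap [IsProbabilityMeasure P] [SigmaFinite ν]
    (hN : IsPoissonRandomMeasure N (intensity ν) P) (hd : 0 < d) (hα : 0 < α) (hα2 : α ≤ 2)
    (hlam : 0 < lam) (hσ : IsLipschitzCoefficient ν σ J K Lip) {C : ℝ} (hC : ∀ x, |u₀ x| ≤ C)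
    (hb : 0 < b) {D : ℝ≥0∞} (hDtop : D ≠ ∞)
    (hu : IsPredictableField (noiseFiltration N hN.measurable P) u)
    (hD : MomentBound P b D u) :
    MomentBound P b (ENNReal.ofReal C + ENNReal.ofReal lam *
      (ENNReal.ofReal (K / b) * (1 + ENNReal.ofReal Lip * D)))
      (mildMap hN α lam σ u₀ u) := by
  intro t x
  have hC' : ∀ y, ‖u₀ y‖ₑ ≤ ENNReal.ofReal C := fun y => by
    rw [Real.enorm_eq_ofReal_abs]; exact ENNReal.ofReal_le_ofReal (hC y)
  rcases eq_or_lt_of_le (zero_le : 0 ≤ t) with rfl | ht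
  · simp only [mildMap_zero, lintegral_const, measure_univ, mul_one]
    calc ‖u₀ x‖ₑ ≤ ENNReal.ofReal C := hC' x
      _ ≤ _ := le_self_add
      _ ≤ _ := le_mul_of_one_le_right zero_le (one_le_ofReal_exp hb 0)
  · have hdet : ‖∫ y, stableDensity α t (x - y) * u₀ y‖ₑ ≤ ENNReal.ofReal C := by
      calc _ ≤ ∫⁻ y, ‖stableDensity α t (x - y) * u₀ y‖ₑ := enorm_integral_le_lintegral_enorm _
        _ ≤ ∫⁻ y, ‖stableDensity α t (x - y)‖ₑ * ENNReal.ofReal C := by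
            refine lintegral_mono fun y => ?_
            rw [enorm_mul]
            gcongr
            exact hC' y
        _ = _ := by
            rw [lintegral_mul_const' _ _ ENNReal.ofReal_ne_top,
              lintegral_enorm_stableDensity_sub hd hα hα2 (by exact_mod_cast ht), one_mul]
    have hI := isPoissonIntegrand_mildIntegrand hN hd hα hα2 hσ hb hDtop hu hD t x
    calc _ ≤ ∫⁻ ω, (ENNReal.ofReal C + ENNReal.ofReal lam *
          ‖poissonIntegral N t (mildIntegrand α σ u t x) ω‖ₑ) ∂P := by
          refine lintegral_mono_ae ?_
          filter_upwards [ae_mildMap_eq hN (u₀ := u₀) (lam := lam) (σ := σ) (u := u) (α := α) ht x]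
            with ω hω
          rw [hω]
          refine (enorm_add_le _ _).trans ?_
          rw [enorm_mul, Real.enorm_of_nonneg hlam.le]
          gcongr
      _ = ENNReal.ofReal C + ENNReal.ofReal lam *
          ∫⁻ ω, ‖poissonIntegral N t (mildIntegrand α σ u t x) ω‖ₑ ∂P := by
          rw [lintegral_add_left measurable_const,
            lintegral_const_mul' _ _ ENNReal.ofReal_ne_top]
          simp
      _ ≤ ENNReal.ofReal C * ENNReal.ofReal (Real.exp (b * t)) + ENNReal.ofReal lam *
          (ENNReal.ofReal (K / b) * (1 + ENNReal.ofReal Lip * D) *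
            ENNReal.ofReal (Real.exp (b * t))) := by
          gcongr
          · exact le_mul_of_one_le_right zero_le (one_le_ofReal_exp hb t)
          · exact (lintegral_enorm_poissonIntegral_le hN hI).trans
              (lintegral_mildIntegrand_le hd hα hα2 hσ hb hD)
      _ = _ := by ring

/-- This is the contraction estimate. It sees `f` and `g` only through almost sure equations, and so
applies both to images of the mild map and to arbitrary solutions. -/
theorem lintegral_mild_sub_le [IsProbabilityMeasure P] [SigmaFinite ν]
    (hN : IsPoissonRandomMeasure N (intensity ν) P) (hd : 0 < d) (hα : 0 < α) (hα2 : α ≤ 2)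
    (hlam : 0 < lam) (hσ : IsLipschitzCoefficient ν σ J K Lip) (hb : 0 < b) {t : ℝ≥0}
    {x : Space d} {D : ℝ≥0∞}
    (hu : IsPoissonIntegrand (noiseFiltration N hN.measurable P) P ν t (mildIntegrand α σ u t x))
    (hv : IsPoissonIntegrand (noiseFiltration N hN.measurable P) P ν t (mildIntegrand α σ v t x))
    (hD : ∀ s y, 0 < s → s < t →
      ∫⁻ ω, ‖u s y ω - v s y ω‖ₑ ∂P ≤ D * ENNReal.ofReal (Real.exp (b * s)))
    {f g : Ω → ℝ} {c : ℝ}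
    (hf : ∀ᵐ ω ∂P, f ω = c + lam * poissonIntegral N t (mildIntegrand α σ u t x) ω)
    (hg : ∀ᵐ ω ∂P, g ω = c + lam * poissonIntegral N t (mildIntegrand α σ v t x) ω) :
    ∫⁻ ω, ‖f ω - g ω‖ₑ ∂P ≤
      ENNReal.ofReal (lam * K * Lip / b) * D * ENNReal.ofReal (Real.exp (b * t)) := by
  calc _ = ∫⁻ ω, ENNReal.ofReal lam * ‖poissonIntegral N t (mildIntegrand α σ u t x) ω -
        poissonIntegral N t (mildIntegrand α σ v t x) ω‖ₑ ∂P := by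
        refine lintegral_congr_ae ?_
        filter_upwards [hf, hg] with ω h1 h2
        rw [h1, h2, add_sub_add_left_eq_sub, ← mul_sub, enorm_mul, Real.enorm_of_nonneg hlam.le]
    _ ≤ ENNReal.ofReal lam * (ENNReal.ofReal (K * Lip / b) * D *
        ENNReal.ofReal (Real.exp (b * t))) := by
        rw [lintegral_const_mul' _ _ ENNReal.ofReal_ne_top]
        gcongr
        exact (lintegral_enorm_poissonIntegral_sub_le hN hu hv).trans
          (lintegral_mildIntegrand_sub_le hd hα hα2 hσ hb hD)
    _ = _ := by
        have : lam * K * Lip / b = lam * (K * Lip / b) := by ring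
        rw [this, ENNReal.ofReal_mul hlam.le]; ring

theorem momentBound_mildMap_sub [IsProbabilityMeasure P] [SigmaFinite ν]
    (hN : IsPoissonRandomMeasure N (intensity ν) P) (hd : 0 < d) (hα : 0 < α) (hα2 : α ≤ 2)
    (hlam : 0 < lam) (hσ : IsLipschitzCoefficient ν σ J K Lip) (hb : 0 < b) {D Du Dv : ℝ≥0∞}
    (hDu : Du ≠ ∞) (hDv : Dv ≠ ∞)
    (hu : IsPredictableField (noiseFiltration N hN.measurable P) u)
    (hv : IsPredictableField (noiseFiltration N hN.measurable P) v)
    (hu' : MomentBound P b Du u) (hv' : MomentBound P b Dv v)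
    (hD : MomentBound P b D (fun t x ω => u t x ω - v t x ω)) :
    MomentBound P b (ENNReal.ofReal (lam * K * Lip / b) * D)
      (fun t x ω => mildMap hN α lam σ u₀ u t x ω - mildMap hN α lam σ u₀ v t x ω) := by
  intro t x
  rcases eq_or_lt_of_le (zero_le : 0 ≤ t) with rfl | ht
  · simp [mildMap_zero]
  · exact lintegral_mild_sub_le hN hd hα hα2 hlam hσ hb
      (isPoissonIntegrand_mildIntegrand hN hd hα hα2 hσ hb hDu hu hu' t x)
      (isPoissonIntegrand_mildIntegrand hN hd hα hα2 hσ hb hDv hv hv' t x)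
      (fun s y _ _ => hD s y) (ae_mildMap_eq hN ht x) (ae_mildMap_eq hN ht x)

/-! ### Picard iteration -/

/-- The Picard iterates of the mild map, started from zero. -/
def picard [SigmaFinite ν] (hN : IsPoissonRandomMeasure N (intensity ν) P) (α lam : ℝ)
    (σ : ℝ → Space d → ℝ) (u₀ : Space d → ℝ) : ℕ → ℝ≥0 → Space d → Ω → ℝ
  | 0 => fun _ _ _ => 0
  | n + 1 => mildMap hN α lam σ u₀ (picard hN α lam σ u₀ n)

theorem isPredictableField_picard [SigmaFinite ν]
    (hN : IsPoissonRandomMeasure N (intensity ν) P) (hσ : Measurable (Function.uncurry σ))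
    (hu₀ : Measurable u₀) (n : ℕ) :
    IsPredictableField (noiseFiltration N hN.measurable P) (picard hN α lam σ u₀ n) := by
  induction n with
  | zero => exact @measurable_const _ _ _ (_) _
  | succ n ih => exact isPredictableField_mildMap hN hσ hu₀ ih

/-- The limit of the Picard iterates. -/
def picardLimit [SigmaFinite ν] (hN : IsPoissonRandomMeasure N (intensity ν) P) (α lam : ℝ)
    (σ : ℝ → Space d → ℝ) (u₀ : Space d → ℝ) : ℝ≥0 → Space d → Ω → ℝ :=
  fun t x ω => limsup (fun n => picard hN α lam σ u₀ n t x ω) atTop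

theorem measurable_limsup_seq {T : Type*} [MeasurableSpace T] {f : ℕ → T → ℝ}
    (hf : ∀ n, Measurable (f n)) : Measurable fun q => limsup (fun n => f n q) atTop :=
  Measurable.limsup hf

/-- A limsup is predictable without any convergence assumption; convergence holds only almost surely
at each `(t, x)`. -/
theorem isPredictableField_picardLimit [SigmaFinite ν]
    (hN : IsPoissonRandomMeasure N (intensity ν) P) (hσ : Measurable (Function.uncurry σ))
    (hu₀ : Measurable u₀) :
    IsPredictableField (noiseFiltration N hN.measurable P) (picardLimit hN α lam σ u₀) :=
  @measurable_limsup_seq _ (_) _ fun n => isPredictableField_picard hN hσ hu₀ n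

/-- The weighted first moment bound of the first Picard iterate. -/
def picardConst (lam K b C : ℝ) : ℝ≥0∞ :=
  ENNReal.ofReal C + ENNReal.ofReal lam * ENNReal.ofReal (K / b)

variable {C : ℝ}

/-- The bound may depend on `n`: only its finiteness matters, to make the iterates admissible
integrands. -/
theorem exists_momentBound_picard [IsProbabilityMeasure P] [SigmaFinite ν]
    (hN : IsPoissonRandomMeasure N (intensity ν) P) (hd : 0 < d) (hα : 0 < α) (hα2 : α ≤ 2)
    (hlam : 0 < lam) (hσ : IsLipschitzCoefficient ν σ J K Lip) (hu₀ : Measurable u₀)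
    (hC : ∀ x, |u₀ x| ≤ C) (hb : 0 < b) (n : ℕ) :
    ∃ D ≠ ∞, MomentBound P b D (picard hN α lam σ u₀ n) := by
  induction n with
  | zero => exact ⟨0, by simp, fun t x => by simp [picard]⟩
  | succ n ih =>
    obtain ⟨D, hD, h⟩ := ih
    refine ⟨_, ?_, momentBound_mildMap hN hd hα hα2 hlam hσ hC hb hD
      (isPredictableField_picard hN hσ.measurable hu₀ n) h⟩
    simp [ENNReal.mul_eq_top, hD]

theorem momentBound_picard_sub [IsProbabilityMeasure P] [SigmaFinite ν]
    (hN : IsPoissonRandomMeasure N (intensity ν) P) (hd : 0 < d) (hα : 0 < α) (hα2 : α ≤ 2)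
    (hlam : 0 < lam) (hσ : IsLipschitzCoefficient ν σ J K Lip) (hu₀ : Measurable u₀)
    (hC : ∀ x, |u₀ x| ≤ C) (hb : 0 < b) (n : ℕ) :
    MomentBound P b (ENNReal.ofReal (lam * K * Lip / b) ^ n * picardConst lam K b C)
      (fun t x ω => picard hN α lam σ u₀ (n + 1) t x ω - picard hN α lam σ u₀ n t x ω) := by
  induction n with
  | zero =>
    -- The first increment is the image of the zero field, so its bound is the one with `D = 0`.
    have h := momentBound_mildMap (u₀ := u₀) (u := fun _ _ _ => 0) hN hd hα hα2 hlam hσ hC hb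
      (D := 0) (by simp) (isPredictableField_picard (α := α) (lam := lam) hN hσ.measurable hu₀ 0)
      (fun t x => by simp)
    simpa [picard, picardConst] using h
  | succ n ih =>
    obtain ⟨D1, h1, h1'⟩ := exists_momentBound_picard hN hd hα hα2 hlam hσ hu₀ hC hb (n + 1)
    obtain ⟨D2, h2, h2'⟩ := exists_momentBound_picard hN hd hα hα2 hlam hσ hu₀ hC hb n
    have h := momentBound_mildMap_sub (u₀ := u₀) hN hd hα hα2 hlam hσ hb h1 h2
      (isPredictableField_picard hN hσ.measurable hu₀ (n + 1))
      (isPredictableField_picard hN hσ.measurable hu₀ n) h1' h2' ih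
    rw [pow_succ', mul_assoc]
    exact h

/-- The expected absolute increments sum geometrically. The increments are therefore almost surely
absolutely summable, and the distance to the limit is at most their tail sum. -/
theorem momentBound_picardLimit_sub [IsProbabilityMeasure P] [SigmaFinite ν]
    (hN : IsPoissonRandomMeasure N (intensity ν) P) (hd : 0 < d) (hα : 0 < α) (hα2 : α ≤ 2)
    (hlam : 0 < lam) (hσ : IsLipschitzCoefficient ν σ J K Lip) (hu₀ : Measurable u₀)
    (hC : ∀ x, |u₀ x| ≤ C) (hb : 0 < b) (hq : ENNReal.ofReal (lam * K * Lip / b) < 1) (n : ℕ) :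
    MomentBound P b (ENNReal.ofReal (lam * K * Lip / b) ^ n *
        ((1 - ENNReal.ofReal (lam * K * Lip / b))⁻¹ * picardConst lam K b C))
      (fun t x ω => picardLimit hN α lam σ u₀ t x ω - picard hN α lam σ u₀ n t x ω) := by
  intro t x
  set q := ENNReal.ofReal (lam * K * Lip / b) with hqdef
  set U := picard hN α lam σ u₀ with hU
  have hm : ∀ k, Measurable (U k t x) := fun k =>
    (isPredictableField_picard hN hσ.measurable hu₀ k).measurable t x
  have hdm : ∀ k, Measurable fun ω => ‖U (k + 1) t x ω - U k t x ω‖ₑ := fun k =>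
    ((hm (k + 1)).sub (hm k)).enorm
  have hsum : ∀ n, ∫⁻ ω, ∑' k, ‖U (n + k + 1) t x ω - U (n + k) t x ω‖ₑ ∂P ≤
      q ^ n * ((1 - q)⁻¹ * picardConst lam K b C) * ENNReal.ofReal (Real.exp (b * t)) := by
    intro n
    rw [lintegral_tsum fun k => (hdm (n + k)).aemeasurable]
    calc _ ≤ ∑' k, q ^ k * (q ^ n * picardConst lam K b C *
          ENNReal.ofReal (Real.exp (b * t))) := by
          refine ENNReal.tsum_le_tsum fun k => ?_
          refine (momentBound_picard_sub hN hd hα hα2 hlam hσ hu₀ hC hb (n + k) t x).trans_eq ?_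
          rw [← hqdef, pow_add]; ring
      _ = _ := by rw [ENNReal.tsum_mul_right, ENNReal.tsum_geometric]; ring
  have hfin : ∫⁻ ω, ∑' k, ‖U (0 + k + 1) t x ω - U (0 + k) t x ω‖ₑ ∂P ≠ ∞ := by
    refine ((hsum 0).trans_lt ?_).ne
    have : (1 - q)⁻¹ < ∞ := ENNReal.inv_lt_top.2 (tsub_pos_of_lt hq)
    simp only [picardConst, pow_zero, one_mul]
    exact ENNReal.mul_lt_top (ENNReal.mul_lt_top this (by simp [ENNReal.mul_lt_top_iff]))
      ENNReal.ofReal_lt_top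
  refine le_trans (lintegral_mono_ae ?_) (hsum n)
  filter_upwards [ae_lt_top (Measurable.tsum fun k => hdm (0 + k)) hfin] with ω hω
  simp only [zero_add] at hω
  have hedist : ∀ k, edist (U k t x ω) (U (k + 1) t x ω) ≤ ‖U (k + 1) t x ω - U k t x ω‖ₑ :=
    fun k => by rw [edist_comm, edist_eq_enorm_sub]
  obtain ⟨a, ha⟩ := cauchySeq_tendsto_of_complete
    (cauchySeq_of_edist_le_of_tsum_ne_top _ hedist hω.ne)
  have hlim : picardLimit hN α lam σ u₀ t x ω = a := ha.limsup_eq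
  have h := edist_le_tsum_of_edist_le_of_tendsto _ hedist ha n
  rw [hlim, ← edist_eq_enorm_sub, edist_comm]
  exact h

theorem momentBound_picardLimit [IsProbabilityMeasure P] [SigmaFinite ν]
    (hN : IsPoissonRandomMeasure N (intensity ν) P) (hd : 0 < d) (hα : 0 < α) (hα2 : α ≤ 2)
    (hlam : 0 < lam) (hσ : IsLipschitzCoefficient ν σ J K Lip) (hu₀ : Measurable u₀)
    (hC : ∀ x, |u₀ x| ≤ C) (hb : 0 < b) (hq : ENNReal.ofReal (lam * K * Lip / b) < 1) :
    ∃ D ≠ ∞, MomentBound P b D (picardLimit hN α lam σ u₀) := by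
  have h := momentBound_picardLimit_sub hN hd hα hα2 hlam hσ hu₀ hC hb hq 0
  refine ⟨_, ?_, by simpa only [picard, sub_zero] using h⟩
  have : (1 - ENNReal.ofReal (lam * K * Lip / b))⁻¹ ≠ ∞ :=
    (ENNReal.inv_lt_top.2 (tsub_pos_of_lt hq)).ne
  rw [pow_zero, one_mul]
  exact ENNReal.mul_ne_top this (by simp [picardConst, ENNReal.mul_eq_top])

/-- With `M` the mild map, compare `u` with `M u` through `U (n+1) = M (U n)`: both distances are of
order `q^{n+1}`, the second by contraction, so the first moment of `u - M u` vanishes. -/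
theorem ae_picardLimit_eq_mildMap [IsProbabilityMeasure P] [SigmaFinite ν]
    (hN : IsPoissonRandomMeasure N (intensity ν) P) (hd : 0 < d) (hα : 0 < α) (hα2 : α ≤ 2)
    (hlam : 0 < lam) (hσ : IsLipschitzCoefficient ν σ J K Lip) (hu₀ : Measurable u₀)
    (hC : ∀ x, |u₀ x| ≤ C) (hb : 0 < b) (hq : ENNReal.ofReal (lam * K * Lip / b) < 1)
    (t : ℝ≥0) (x : Space d) :
    ∀ᵐ ω ∂P, picardLimit hN α lam σ u₀ t x ω =
      mildMap hN α lam σ u₀ (picardLimit hN α lam σ u₀) t x ω := by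
  set q := ENNReal.ofReal (lam * K * Lip / b) with hqdef
  set U := picard hN α lam σ u₀ with hU
  set u := picardLimit hN α lam σ u₀ with hu
  have hup : IsPredictableField (noiseFiltration N hN.measurable P) u :=
    isPredictableField_picardLimit hN hσ.measurable hu₀
  have hUp := fun n => isPredictableField_picard (α := α) (lam := lam) hN hσ.measurable hu₀ n
  obtain ⟨Du, hDu, hDu'⟩ := momentBound_picardLimit hN hd hα hα2 hlam hσ hu₀ hC hb hq
  set D := (1 - q)⁻¹ * picardConst lam K b C with hDdef
  have hDtop : D ≠ ∞ := by
    have : (1 - q)⁻¹ ≠ ∞ := (ENNReal.inv_lt_top.2 (tsub_pos_of_lt hq)).ne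
    exact ENNReal.mul_ne_top this (by simp [picardConst, ENNReal.mul_eq_top])
  set A := D * ENNReal.ofReal (Real.exp (b * t)) with hA
  have hAtop : A ≠ ∞ := ENNReal.mul_ne_top hDtop ENNReal.ofReal_ne_top
  have hbound : ∀ n : ℕ, ∫⁻ ω, ‖u t x ω - mildMap hN α lam σ u₀ u t x ω‖ₑ ∂P ≤
      q ^ (n + 1) * (A + A) := by
    intro n
    obtain ⟨Dn, hDn, hDn'⟩ := exists_momentBound_picard hN hd hα hα2 hlam hσ hu₀ hC hb n
    have h1 := momentBound_picardLimit_sub hN hd hα hα2 hlam hσ hu₀ hC hb hq (n + 1) t x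
    have h2 : MomentBound P b (q ^ n * D) (fun t x ω => U n t x ω - u t x ω) := fun t x => by
      have := momentBound_picardLimit_sub hN hd hα hα2 hlam hσ hu₀ hC hb hq n t x
      simp only [enorm_sub_rev (U n t x _)]
      exact this
    have h3 := momentBound_mildMap_sub (u₀ := u₀) hN hd hα hα2 hlam hσ hb hDn hDu (hUp n) hup
      hDn' hDu' h2 t x
    have hm : Measurable fun ω => ‖u t x ω - U (n + 1) t x ω‖ₑ :=
      ((hup.measurable t x).sub ((hUp (n + 1)).measurable t x)).enorm
    calc _ ≤ ∫⁻ ω, (‖u t x ω - U (n + 1) t x ω‖ₑ +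
          ‖U (n + 1) t x ω - mildMap hN α lam σ u₀ u t x ω‖ₑ) ∂P := by
          refine lintegral_mono fun ω => ?_
          rw [← sub_add_sub_cancel (u t x ω) (U (n + 1) t x ω)]
          exact enorm_add_le _ _
      _ = ∫⁻ ω, ‖u t x ω - U (n + 1) t x ω‖ₑ ∂P +
          ∫⁻ ω, ‖U (n + 1) t x ω - mildMap hN α lam σ u₀ u t x ω‖ₑ ∂P :=
          lintegral_add_left hm _
      _ ≤ q ^ (n + 1) * D * ENNReal.ofReal (Real.exp (b * t)) +
          q * (q ^ n * D) * ENNReal.ofReal (Real.exp (b * t)) := add_le_add h1 h3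
      _ = _ := by rw [hA, pow_succ]; ring
  have hzero : ∫⁻ ω, ‖u t x ω - mildMap hN α lam σ u₀ u t x ω‖ₑ ∂P = 0 := by
    have hlim : Tendsto (fun n : ℕ => q ^ (n + 1) * (A + A)) atTop (𝓝 0) := by
      have h1 := (ENNReal.tendsto_pow_atTop_nhds_zero_of_lt_one hq).comp (tendsto_add_atTop_nat 1)
      have h2 := ENNReal.Tendsto.mul_const (b := A + A) h1
        (Or.inr (ENNReal.add_ne_top.2 ⟨hAtop, hAtop⟩))
      simpa using h2
    exact le_antisymm (ge_of_tendsto' hlim hbound) zero_le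
  have hm : Measurable fun ω => ‖u t x ω - mildMap hN α lam σ u₀ u t x ω‖ₑ :=
    ((hup.measurable t x).sub
      ((isPredictableField_mildMap hN hσ.measurable hu₀ hup).measurable t x)).enorm
  filter_upwards [(lintegral_eq_zero_iff hm).1 hzero] with ω hω
  simpa [sub_eq_zero] using hω

/-! ### Existence and uniqueness -/

theorem isRandomFieldSolution_picardLimit [IsProbabilityMeasure P] [SigmaFinite ν]
    (hN : IsPoissonRandomMeasure N (intensity ν) P) (hd : 0 < d) (hα : 0 < α) (hα2 : α ≤ 2)
    (hlam : 0 < lam) (hσ : IsLipschitzCoefficient ν σ J K Lip) (hu₀ : Measurable u₀)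
    (hC : ∀ x, |u₀ x| ≤ C) (hb : 0 < b) (hq : ENNReal.ofReal (lam * K * Lip / b) < 1) :
    IsRandomFieldSolution P ν N hN.measurable α lam σ u₀ (picardLimit hN α lam σ u₀) := by
  have hup : IsPredictableField (noiseFiltration N hN.measurable P)
    (picardLimit hN α lam σ u₀) := isPredictableField_picardLimit hN hσ.measurable hu₀
  obtain ⟨D, hD, hD'⟩ := momentBound_picardLimit hN hd hα hα2 hlam hσ hu₀ hC hb hq
  have hfix := ae_picardLimit_eq_mildMap hN hd hα hα2 hlam hσ hu₀ hC hb hq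
  refine ⟨hup, fun x => ?_, fun t _ x => ?_, fun t ht x => ?_, fun T => ?_⟩
  · filter_upwards [hfix 0 x] with ω hω
    rw [hω, mildMap_zero]
  · exact isPoissonIntegrand_mildIntegrand hN hd hα hα2 hσ hb hD hup hD' t x
  · filter_upwards [hfix t x, ae_mildMap_eq hN ht x] with ω h1 h2
    rw [h1, h2]
  · refine lt_of_le_of_lt (iSup_le fun t => iSup_le fun ht => iSup_le fun x => ?_)
      (ENNReal.mul_lt_top hD.lt_top (ENNReal.ofReal_lt_top (r := Real.exp (b * T))))
    refine (hD' t x).trans ?_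
    gcongr

theorem firstMomentNorm_lt_top {D : ℝ≥0∞} (hD : D ≠ ∞) (h : MomentBound P b D u) :
    firstMomentNorm P b u < ∞ := by
  refine lt_of_le_of_lt (iSup_le fun t => iSup_le fun x => ?_) hD.lt_top
  calc _ ≤ ENNReal.ofReal (Real.exp (-(b * t))) * (D * ENNReal.ofReal (Real.exp (b * t))) := by
        gcongr
        exact h t x
    _ = D * ENNReal.ofReal (Real.exp (-(b * t)) * Real.exp (b * t)) := by
        rw [ENNReal.ofReal_mul (Real.exp_pos _).le]; ring
    _ = D := by rw [← Real.exp_add]; simp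

/-- Solutions have moments bounded only locally in time, so the contraction is run on `[0, T]`,
where the weighted distance `D` is finite; then `D ≤ q D` with `q < 1` forces `D = 0`. -/
theorem IsRandomFieldSolution.ae_eq [IsProbabilityMeasure P] [SigmaFinite ν]
    (hN : IsPoissonRandomMeasure N (intensity ν) P) (hd : 0 < d) (hα : 0 < α) (hα2 : α ≤ 2)
    (hlam : 0 < lam) (hσ : IsLipschitzCoefficient ν σ J K Lip)
    (hu : IsRandomFieldSolution P ν N hN.measurable α lam σ u₀ u)
    (hv : IsRandomFieldSolution P ν N hN.measurable α lam σ u₀ v)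
    (hb : 0 < b) (hq : ENNReal.ofReal (lam * K * Lip / b) < 1) (T : ℝ≥0) (x : Space d) :
    ∀ᵐ ω ∂P, v T x ω = u T x ω := by
  set q := ENNReal.ofReal (lam * K * Lip / b) with hqdef
  have hm : ∀ t x, Measurable fun ω => ‖v t x ω - u t x ω‖ₑ := fun t x =>
    ((hv.predictable.measurable t x).sub (hu.predictable.measurable t x)).enorm
  set D : ℝ≥0∞ := ⨆ (t : ℝ≥0) (_ : t ≤ T) (x : Space d),
    ENNReal.ofReal (Real.exp (-(b * t))) * ∫⁻ ω, ‖v t x ω - u t x ω‖ₑ ∂P with hD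
  have hexp : ∀ t : ℝ≥0, ENNReal.ofReal (Real.exp (-(b * t))) *
      ENNReal.ofReal (Real.exp (b * t)) = 1 := fun t => by
    rw [← ENNReal.ofReal_mul (Real.exp_pos _).le, ← Real.exp_add]; simp
  have hle : ∀ t ≤ T, ∀ x, ∫⁻ ω, ‖v t x ω - u t x ω‖ₑ ∂P ≤
      D * ENNReal.ofReal (Real.exp (b * t)) := by
    intro t ht x
    have h1 : ENNReal.ofReal (Real.exp (-(b * t))) * ∫⁻ ω, ‖v t x ω - u t x ω‖ₑ ∂P ≤ D :=
      le_iSup_of_le t (le_iSup_of_le ht (le_iSup_of_le x le_rfl))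
    calc _ = (ENNReal.ofReal (Real.exp (-(b * t))) * ∫⁻ ω, ‖v t x ω - u t x ω‖ₑ ∂P) *
          ENNReal.ofReal (Real.exp (b * t)) := by
          rw [mul_right_comm, hexp, one_mul]
      _ ≤ _ := by gcongr
  have hDtop : D ≠ ∞ := by
    refine (lt_of_le_of_lt (iSup_le fun t => iSup_le fun ht => iSup_le fun x => ?_)
      (ENNReal.add_lt_top.2 ⟨hv.moment T, hu.moment T⟩)).ne
    have h1 : ∫⁻ ω, ‖v t x ω‖ₑ ∂P ≤ ⨆ (t : ℝ≥0) (_ : t ≤ T) (x : Space d),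
      ∫⁻ ω, ‖v t x ω‖ₑ ∂P := le_iSup_of_le t (le_iSup_of_le ht (le_iSup_of_le x le_rfl))
    have h2 : ∫⁻ ω, ‖u t x ω‖ₑ ∂P ≤ ⨆ (t : ℝ≥0) (_ : t ≤ T) (x : Space d),
      ∫⁻ ω, ‖u t x ω‖ₑ ∂P := le_iSup_of_le t (le_iSup_of_le ht (le_iSup_of_le x le_rfl))
    have h3 : ENNReal.ofReal (Real.exp (-(b * t))) ≤ 1 := by
      rw [← ENNReal.ofReal_one]
      exact ENNReal.ofReal_le_ofReal (Real.exp_le_one_iff.2 (neg_nonpos.2 (by positivity)))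
    calc _ ≤ 1 * ∫⁻ ω, (‖v t x ω‖ₑ + ‖u t x ω‖ₑ) ∂P := by
          gcongr with ω
          exact enorm_sub_le
      _ ≤ _ := by
          rw [one_mul, lintegral_add_left (hv.predictable.measurable t x).enorm]
          exact add_le_add h1 h2
  have hcontr : D ≤ q * D := by
    refine iSup_le fun t => iSup_le fun ht => iSup_le fun x => ?_
    rcases eq_or_lt_of_le (zero_le : 0 ≤ t) with rfl | ht0
    · have : ∫⁻ ω, ‖v 0 x ω - u 0 x ω‖ₑ ∂P = 0 := by
        rw [lintegral_eq_zero_iff (hm 0 x)]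
        filter_upwards [hu.initial x, hv.initial x] with ω h1 h2
        simp [h1, h2]
      rw [this, mul_zero]
      exact zero_le
    · have h := lintegral_mild_sub_le hN hd hα hα2 hlam hσ hb (hv.integrand t ht0 x)
        (hu.integrand t ht0 x) (fun s y _ hs => hle s (hs.le.trans ht) y)
        (hv.mild t ht0 x) (hu.mild t ht0 x)
      calc _ ≤ ENNReal.ofReal (Real.exp (-(b * t))) *
            (q * D * ENNReal.ofReal (Real.exp (b * t))) := by gcongr
        _ = q * D := by rw [mul_left_comm, hexp, mul_one]
  have hD0 : D = 0 := by
    by_contra hne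
    have : q * D < 1 * D := ENNReal.mul_lt_mul_left hne hDtop hq
    rw [one_mul] at this
    exact absurd hcontr (not_le.2 this)
  have hz : ∫⁻ ω, ‖v T x ω - u T x ω‖ₑ ∂P = 0 := by
    have := hle T le_rfl x
    rw [hD0, zero_mul] at this
    exact le_antisymm this zero_le
  filter_upwards [(lintegral_eq_zero_iff (hm T x)).1 hz] with ω hω
  simpa [sub_eq_zero] using hω

end Estimates

end StableSHE

end

/-! ### The main theorem -/

theorem theorem4p4 {d : ℕ} (hd : 0 < d) {α β lam K Lip : ℝ}
    (hα0 : 0 < α) (hα2 : α ≤ 2) (hβ : 0 < β) (hlam : 0 < lam) (hK : 0 < K) (hLip : 0 < Lip)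
    {Ω : Type*} [MeasurableSpace Ω] (P : Measure Ω) [IsProbabilityMeasure P]
    -- the Lévy measure and the Poisson random measure
    (ν : Measure (StableSHE.Space d))
    (hν : ∫⁻ h, ENNReal.ofReal (min 1 (‖h‖ ^ 2)) ∂ν < ∞)
    (N : Ω → Measure (ℝ≥0 × StableSHE.Space d × StableSHE.Space d))
    (hN : StableSHE.IsPoissonRandomMeasure N (StableSHE.intensity ν) P)
    -- the initial condition
    (u₀ : StableSHE.Space d → ℝ) (hu₀_meas : Measurable u₀) (hu₀_nonneg : ∀ x, 0 ≤ u₀ x)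
    (hu₀_bdd : ∃ c : ℝ, ∀ x, u₀ x ≤ c)
    -- the coefficient
    (σ : ℝ → StableSHE.Space d → ℝ) (hσ_meas : Measurable (Function.uncurry σ))
    (J : StableSHE.Space d → ℝ) (hJ_meas : Measurable J) (hJ_pos : ∀ h, 0 < J h)
    (hJ_int : ∫⁻ h, ENNReal.ofReal (J h) ∂ν ≤ ENNReal.ofReal K)
    (hσ_zero : ∀ h, |σ 0 h| ≤ J h)
    (hσ_lip : ∀ x y h, |σ x h - σ y h| ≤ J h * Lip * |x - y|)
    -- the condition on the constants
    (hC : StableSHE.solutionConst d α β < ENNReal.ofReal (1 / (lam * K * Lip))) :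
    ∃ u : ℝ≥0 → StableSHE.Space d → Ω → ℝ,
      StableSHE.IsRandomFieldSolution P ν N hN.measurable α lam σ u₀ u ∧
      (d = 1 → StableSHE.firstMomentNorm P β u < ∞) ∧
      (∀ β' : ℝ, lam * K * Lip < β' → StableSHE.firstMomentNorm P β' u < ∞) ∧
      ∀ v : ℝ≥0 → StableSHE.Space d → Ω → ℝ,
        StableSHE.IsRandomFieldSolution P ν N hN.measurable α lam σ u₀ v →
        ∀ t x, ∀ᵐ ω ∂P, v t x ω = u t x ω := by
  have hσ : StableSHE.IsLipschitzCoefficient ν σ J K Lip :=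
    ⟨hK.le, hLip.le, hσ_meas, hJ_meas, fun h => (hJ_pos h).le, hJ_int, hσ_zero, hσ_lip⟩
  have : SigmaFinite ν := StableSHE.sigmaFinite_of_lintegral_lt_top hJ_meas hJ_pos
    (hJ_int.trans_lt ENNReal.ofReal_lt_top).ne
  obtain ⟨c, hc⟩ := hu₀_bdd
  have hc' : ∀ x, |u₀ x| ≤ c := fun x => by rw [abs_of_nonneg (hu₀_nonneg x)]; exact hc x
  have hL : 0 < lam * K * Lip := by positivity
  have hq : ∀ b, lam * K * Lip < b → 0 < b ∧ ENNReal.ofReal (lam * K * Lip / b) < 1 := by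
    intro b hb
    have hb0 : 0 < b := hL.trans hb
    exact ⟨hb0, ENNReal.ofReal_lt_one.2 ((div_lt_one hb0).2 hb)⟩
  have hnorm : ∀ b, lam * K * Lip < b →
      StableSHE.firstMomentNorm P b (StableSHE.picardLimit hN α lam σ u₀) < ∞ := by
    intro b hb
    obtain ⟨D, hD, hD'⟩ := StableSHE.momentBound_picardLimit hN hd hα0 hα2 hlam hσ hu₀_meas hc'
      (hq b hb).1 (hq b hb).2
    exact StableSHE.firstMomentNorm_lt_top hD hD'
  -- Any weight above `lam * K * Lip` would do. `picardLimit` does not depend on the weight, so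
  -- `hnorm` bounds this same solution for every admissible one.
  obtain ⟨hb, hqb⟩ := hq (lam * K * Lip + 1) (lt_add_one _)
  have hsol := StableSHE.isRandomFieldSolution_picardLimit hN hd hα0 hα2 hlam hσ hu₀_meas hc' hb
    hqb
  refine ⟨StableSHE.picardLimit hN α lam σ u₀, hsol, fun h1 => ?_, hnorm, fun v hv t x =>
    StableSHE.IsRandomFieldSolution.ae_eq hN hd hα0 hα2 hlam hσ hsol hv hb hqb t x⟩
  -- In dimension one the condition on the constants gives `lam * K * Lip < β`, so `β` is itself an
  -- admissible weight.
  subst h1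
  exact hnorm β (StableSHE.lt_of_solutionConst_lt hα0 hα2 hβ hL hC)
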